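/- **Setting.** There are $m\ge 1$ users, dimension $d\ge 1$, and a finite action set $\mathcal A\subset\mathbb R^d$ with $|\mathcal A|=k\ge 1$ and $\|x\|_2\le 1$ for all $x\in\mathcal A$. The user parameters $\theta_1,\dots,\theta_m$ are i.i.d. $\mathcal N(\mu,C)$ with $C=\sigma^2 I$, $\|\mu\|_2\le1$, $0\le\sigma\le1$. When user $i$ plays $x_{i,t}\in\mathcal A$ in round $t$ it receives $\langle x_{i,t},\theta_i\rangle+\epsilon_{i,t}$, where the $\epsilon_{i,t}$ are i.i.d. $\mathcal N(0,1)$, independent of the parameters. The joint pseudo-regret is $\hat R_{m,n}(\mu)=\sum_{i=1}^m\sum_{t=1}^n\big(\max_{x\in\mathcal A}\langle x,\theta_i\rangle-\langle x_{i,t},\theta_i\rangle\big)$. **Algorithm CP-PE** (input $\mathcal A,d,m,n,\sigma,\delta$). For $S\subseteq\mathcal A$ nonempty, a design on $S$ is a probability vector $\pi$ on $S$ whose support spans $\mathrm{span}(S)$; put $V(\pi)=\sum_x\pi(x)xx^\top$ and $g(\pi)=\max_{x\in S}x^\top V(\pi)^\dagger x$. A G-optimal design minimizes $g$ among the designs on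 $S$. Let $\varepsilon_\ell=2^{-\ell}$ and $$h=\sqrt{2\max_{x\in\mathcal A}\|x\|_C^2\,\log\tfrac{4km}{\delta}}+\sqrt{\tfrac2m\max_{x\in\mathcal A}\|x\|_C^2\,\log\tfrac{4k}{\delta}},\qquad \|x\|_C^2=x^\top Cx .$$ Start with $\mathcal A_{i,1}=\mathcal A$ for all users $i$. In phase $\ell=1,2,\dots$, user $i$ takes a G-optimal design $\pi$ on $\mathcal A_{i,\ell}$ with at most $d(d+1)/2$ support points, computed by a fixed rule from $\mathcal A_{i,\ell}$, and plays each $x$ in its support $n_{i,\ell}(x)$ times (and the other actions not at all), where $$n_{i,\ell}(x)=\Big\lceil\tfrac{8\pi(x)g(\pi)}{m\varepsilon_\ell^2}\log\tfrac{2k\ell(\ell+1)}{\delta}\Big\rceil\ \text{ if } h\le\tfrac{\varepsilon_\ell}{2}\text{ (collaborative)},\qquad n_{i,\ell}(x)=\Big\lceil\tfrac{2\pi(x)g(\pi)}{\varepsilon_\ell^2}\log\tfrac{2km\ell(\ell+1)}{\delta}\Big\rceil\ \text{ otherwise (personalized)},$$ but at least once. With $X_i$, $y_i$ the matrix of actions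 and the vector of rewards of user $i$ in this phase, let $\hat\theta_i=(X_i^\top X_i)^\dagger X_i^\top y_i$, and let $w_i=\frac1m\sum_{j}\hat\theta_j$ in a collaborative phase and $w_i=\hat\theta_i$ in a personalized one. Then $\mathcal A_{i,\ell+1}=\{x\in\mathcal A_{i,\ell}:\max_{x'\in\mathcal A_{i,\ell}}\langle w_i,x'-x\rangle\le2\varepsilon_\ell\}$. Each user stops after $n$ rounds. **Theorem.** Let $n\ge\min\{k,d^2\}$ and $\delta\in(0,1)$. Then with probability at least $1-\delta$ the regret of CP-PE satisfies * $\hat R_{m,n}(\mu)=\tilde O\big(\sqrt{dmn}+md^2\big)$ when $n=o\big(d/(m\sigma^2)\big)$; * $\hat R_{m,n}(\mu)=\tilde O\big(m^{1-\gamma}\sqrt{dn}+md^2\big)$ when $n=\Theta\big(d/(m^{2\gamma}\sigma^2)\big)$, $\gamma\in[0,\tfrac12]$; * $\hat R_{m,n}(\mu)=\tilde O\big(m\sqrt{dn}+md^2\big)$ when $n=\omega\big(d/\sigma^2\big)$. This is meant in the following uniform, non-asymptotic sense. There is an absolute exponent $p$ such that: for every $c>0$ there is $K$ such that for all $d,m,k,n,\sigma,\delta,\mathcal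 A,\mu$ as above with $nm\sigma^2\le c\,d$, with probability at least $1-\delta$, $\hat R_{m,n}(\mu)\le K\,(1+\log\frac{kmn}{\delta})^p(\sqrt{dmn}+md^2)$; for all $c_1,c_2>0$ there is $K$ such that the same holds for all $\gamma\in[0,\frac12]$ with $m^{1-\gamma}\sqrt{dn}+md^2$ in the last factor whenever $c_1d\le nm^{2\gamma}\sigma^2\le c_2d$; and for every $c>0$ there is $K$ such that the same holds with $m\sqrt{dn}+md^2$ whenever $n\sigma^2\ge c\,d$. (In particular the first claim covers $n=o(d/(m\sigma^2))$ and the third $n=\omega(d/\sigma^2)$ along any sequence of problems.) -/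

import Mathlib

open MeasureTheory ProbabilityTheory Matrix
open scoped BigOperators RealInnerProductSpace

universe u

namespace CPPE

noncomputable section

/-! Throughout, `d` is the dimension, `m` the number of users and `k` the number of actions. The
finite action set is `{a 0, …, a (k-1)}`, with `a : Fin k → ℝᵈ` injective, so a set of actions is
given by a `Finset (Fin k)`. Users are indexed by `Fin m` and rounds by `ℕ`, starting at `0`. -/

/-- The pseudo-inverse of a real symmetric matrix: in an eigendecomposition, invert the nonzero
eigenvalues and leave the zero eigenvalues unchanged (recall `(0 : ℝ)⁻¹ = 0`). -/
def pinv {d : ℕ} (A : Matrix (Fin d) (Fin d) ℝ) : Matrix (Fin d) (Fin d) ℝ :=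
  cfc (fun t : ℝ => t⁻¹) A

/-- The squared seminorm `‖v‖²_M = vᵀ M v`. -/
def quad {d : ℕ} (M : Matrix (Fin d) (Fin d) ℝ) (v : EuclideanSpace ℝ (Fin d)) : ℝ :=
  v.ofLp ⬝ᵥ (M *ᵥ v.ofLp)

/-! ### G-optimal designs -/

/-- `V(π) = ∑ₓ π(x) x xᵀ`. -/
def infoMatrix {d k : ℕ} (a : Fin k → EuclideanSpace ℝ (Fin d)) (w : Fin k → ℝ) :
    Matrix (Fin d) (Fin d) ℝ :=
  ∑ x, w x • vecMulVec (a x).ofLp (a x).ofLp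

/-- `g(π) = max_{x ∈ S} ‖x‖²_{V(π)†}`. -/
def gValue {d k : ℕ} (a : Fin k → EuclideanSpace ℝ (Fin d)) (S : Finset (Fin k))
    (w : Fin k → ℝ) : ℝ :=
  ⨆ x : {x // x ∈ S}, quad (pinv (infoMatrix a w)) (a x)

/-- A design on `S`: a probability distribution on the actions in `S`, whose support spans the
linear span of `S` (otherwise some action of `S` cannot be estimated and `g` counts as `+∞`). -/
structure IsDesign {d k : ℕ} (a : Fin k → EuclideanSpace ℝ (Fin d)) (S : Finset (Fin k))
    (w : Fin k → ℝ) : Prop where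
  nonneg : ∀ x, 0 ≤ w x
  eq_zero : ∀ x, x ∉ S → w x = 0
  sum_eq_one : ∑ x, w x = 1
  span_eq : Submodule.span ℝ (a '' {x | w x ≠ 0}) = Submodule.span ℝ (a '' {x | x ∈ S})

/-- A G-optimal design on `S`: a minimizer of `g` among the designs on `S`. -/
def IsGOptimal {d k : ℕ} (a : Fin k → EuclideanSpace ℝ (Fin d)) (S : Finset (Fin k))
    (w : Fin k → ℝ) : Prop :=
  IsDesign a S w ∧ ∀ w', IsDesign a S w' → gValue a S w ≤ gValue a S w'

/-- A subroutine that finds, for each nonempty set of actions, a G-optimal design with at most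
`d(d+1)/2` support points. -/
def IsDesignRule {d k : ℕ} (a : Fin k → EuclideanSpace ℝ (Fin d))
    (D : Finset (Fin k) → Fin k → ℝ) : Prop :=
  ∀ S : Finset (Fin k), S.Nonempty →
    IsGOptimal a S (D S) ∧ {x | D S x ≠ 0}.ncard ≤ d * (d + 1) / 2

/-! ### The algorithm -/

/-- The target error `ε_ℓ = 2^{-ℓ}` of phase `ℓ`. -/
def eps (l : ℕ) : ℝ := (1 / 2) ^ l

/-- The threshold `h`, computed from the population covariance `C` and the confidence `δ`. -/
def threshold {d k : ℕ} (m : ℕ) (a : Fin k → EuclideanSpace ℝ (Fin d))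
    (C : Matrix (Fin d) (Fin d) ℝ) (δ : ℝ) : ℝ :=
  √(2 * (⨆ x, quad C (a x)) * Real.log (4 * k * m / δ))
    + √(2 / m * (⨆ x, quad C (a x)) * Real.log (4 * k / δ))

/-- Phase `l` belongs to the collaborative stage. -/
def IsCollab {d k : ℕ} (m : ℕ) (a : Fin k → EuclideanSpace ℝ (Fin d))
    (C : Matrix (Fin d) (Fin d) ℝ) (δ : ℝ) (l : ℕ) : Prop :=
  threshold m a C δ ≤ eps l / 2

open Classical in
/-- The number of times a user with active set `S` plays each action in phase `l`. Every action in
the support of the design is played at least once: the value of the ceiling is already at least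
one there, unless all actions of `S` are zero (then `g = 0`). -/
def pulls {d k : ℕ} (m : ℕ) (a : Fin k → EuclideanSpace ℝ (Fin d))
    (C : Matrix (Fin d) (Fin d) ℝ) (δ : ℝ) (D : Finset (Fin k) → Fin k → ℝ)
    (l : ℕ) (S : Finset (Fin k)) (x : Fin k) : ℕ :=
  if D S x = 0 then 0
  else if IsCollab m a C δ l then
    max 1 ⌈8 * D S x * gValue a S (D S) / (m * eps l ^ 2)
      * Real.log (2 * k * l * (l + 1) / δ)⌉₊
  else
    max 1 ⌈2 * D S x * gValue a S (D S) / eps l ^ 2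
      * Real.log (2 * k * m * l * (l + 1) / δ)⌉₊

/-- The actions that a user with active set `S` plays in phase `l`, in the order of play. -/
def phaseList {d k : ℕ} (m : ℕ) (a : Fin k → EuclideanSpace ℝ (Fin d))
    (C : Matrix (Fin d) (Fin d) ℝ) (δ : ℝ) (D : Finset (Fin k) → Fin k → ℝ)
    (l : ℕ) (S : Finset (Fin k)) : List (Fin k) :=
  (List.finRange k).flatMap fun x => List.replicate (pulls m a C δ D l S x) x

/-- The least squares estimate `(XᵀX)† Xᵀ y`, where the rows of `X` are the actions played. -/
def lsEstimate {d k : ℕ} (a : Fin k → EuclideanSpace ℝ (Fin d)) (L : List (Fin k))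
    (y : Fin L.length → ℝ) : EuclideanSpace ℝ (Fin d) :=
  let X : Matrix (Fin L.length) (Fin d) ℝ := Matrix.of fun s => (a (L.get s)).ofLp
  WithLp.toLp 2 (pinv (Xᵀ * X) *ᵥ (Xᵀ *ᵥ y))

/-- What the algorithm holds at the beginning of a phase: for each user the active set and the
number of rounds played so far. -/
structure PhaseState (m k : ℕ) where
  active : Fin m → Finset (Fin k)
  start : Fin m → ℕ

open Classical in
/-- Phase `l` of the algorithm, for the user parameters `θ` and the noise `ξ`: user `i` receives
the reward `⟪x, θ i⟫ + ξ i t` for playing `x` in round `t`. In a collaborative phase all users use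
the average of the users' estimates (in the collaborative stage they all have the same active set,
hence the same design), in a personalized phase each user uses its own estimate. -/
def runPhase {d m k : ℕ} (a : Fin k → EuclideanSpace ℝ (Fin d))
    (C : Matrix (Fin d) (Fin d) ℝ) (δ : ℝ) (D : Finset (Fin k) → Fin k → ℝ)
    (θ : Fin m → EuclideanSpace ℝ (Fin d)) (ξ : Fin m → ℕ → ℝ)
    (l : ℕ) (st : PhaseState m k) : PhaseState m k :=
  let L : Fin m → List (Fin k) := fun i => phaseList m a C δ D l (st.active i)
  let own : Fin m → EuclideanSpace ℝ (Fin d) := fun i =>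
    lsEstimate a (L i) fun s => ⟪a ((L i).get s), θ i⟫ + ξ i (st.start i + s)
  let est : Fin m → EuclideanSpace ℝ (Fin d) := fun i =>
    if IsCollab m a C δ l then (1 / (m : ℝ)) • ∑ j, own j else own i
  { active := fun i => (st.active i).filter fun x =>
      ∀ x' ∈ st.active i, ⟪est i, a x' - a x⟫ ≤ 2 * eps l
    start := fun i => st.start i + (L i).length }

/-- The state at the beginning of phase `j + 1`. The phases are numbered `1, 2, …`. -/
def stateAt {d m k : ℕ} (a : Fin k → EuclideanSpace ℝ (Fin d))
    (C : Matrix (Fin d) (Fin d) ℝ) (δ : ℝ) (D : Finset (Fin k) → Fin k → ℝ)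
    (θ : Fin m → EuclideanSpace ℝ (Fin d)) (ξ : Fin m → ℕ → ℝ) : ℕ → PhaseState m k
  | 0 => { active := fun _ => Finset.univ, start := fun _ => 0 }
  | j + 1 => runPhase a C δ D θ ξ (j + 1) (stateAt a C δ D θ ξ j)

/-- The action `x_{i,t}` that user `i` plays in round `t`: with `j + 1` the phase in which round `t`
falls for user `i`, the entry of the list of that phase at the position of round `t`. (Each phase
lasts at least one round, so that `j ≤ t`, and the default value `0` is never used.) -/
def action {d m k : ℕ} (a : Fin k → EuclideanSpace ℝ (Fin d))
    (C : Matrix (Fin d) (Fin d) ℝ) (δ : ℝ) (D : Finset (Fin k) → Fin k → ℝ)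
    (θ : Fin m → EuclideanSpace ℝ (Fin d)) (ξ : Fin m → ℕ → ℝ) (i : Fin m) (t : ℕ) :
    EuclideanSpace ℝ (Fin d) :=
  let st := stateAt a C δ D θ ξ
  let j := Nat.findGreatest (fun j => (st j).start i ≤ t) t
  ((phaseList m a C δ D (j + 1) ((st j).active i)).map a).getD (t - (st j).start i) 0

/-- The joint pseudo-regret over `n` rounds. -/
def regret {d m k : ℕ} (a : Fin k → EuclideanSpace ℝ (Fin d))
    (C : Matrix (Fin d) (Fin d) ℝ) (δ : ℝ) (D : Finset (Fin k) → Fin k → ℝ) (n : ℕ)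
    (θ : Fin m → EuclideanSpace ℝ (Fin d)) (ξ : Fin m → ℕ → ℝ) : ℝ :=
  ∑ i, ∑ t ∈ Finset.range n, ((⨆ x, ⟪a x, θ i⟫) - ⟪action a C δ D θ ξ i t, θ i⟫)

/-! ### The hierarchical model -/

/-- The parameters `θ i` are i.i.d. `N(μ, C)`, the noises `ξ i t` are i.i.d. `N(0, 1)`, and the
noises are independent of the parameters. -/
structure IsModel {d m : ℕ} {Ω : Type u} [MeasurableSpace Ω] (P : Measure Ω)
    (μ : EuclideanSpace ℝ (Fin d)) (C : Matrix (Fin d) (Fin d) ℝ)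
    (θ : Fin m → Ω → EuclideanSpace ℝ (Fin d)) (ξ : Fin m → ℕ → Ω → ℝ) : Prop where
  param_law : ∀ i, HasLaw (θ i) (multivariateGaussian μ C) P
  noise_law : ∀ i t, HasLaw (ξ i t) (gaussianReal 0 1) P
  param_indep : iIndepFun θ P
  noise_indep : iIndepFun (fun q : Fin m × ℕ => ξ q.1 q.2) P
  indep : IndepFun (fun ω (i : Fin m) => θ i ω) (fun ω (q : Fin m × ℕ) => ξ q.1 q.2 ω) P

/-- For all action sets of size `k` in the unit ball, all means `μ` in the unit ball and population
covariance `σ² I`, the algorithm run with confidence `δ` has joint pseudo-regret at most `B` over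
`n` rounds with probability at least `1 - δ`. -/
def RegretAtMost (d m k n : ℕ) (σ δ B : ℝ) : Prop :=
  ∀ (a : Fin k → EuclideanSpace ℝ (Fin d)), Function.Injective a → (∀ x, ‖a x‖ ≤ 1) →
  ∀ (D : Finset (Fin k) → Fin k → ℝ), IsDesignRule a D →
  ∀ (μ : EuclideanSpace ℝ (Fin d)), ‖μ‖ ≤ 1 →
  ∀ (Ω : Type u) [MeasurableSpace Ω] (P : Measure Ω) [IsProbabilityMeasure P]
    (θ : Fin m → Ω → EuclideanSpace ℝ (Fin d)) (ξ : Fin m → ℕ → Ω → ℝ),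
  IsModel P μ (σ ^ 2 • (1 : Matrix (Fin d) (Fin d) ℝ)) θ ξ →
    1 - δ ≤ P.real {ω | regret a (σ ^ 2 • (1 : Matrix (Fin d) (Fin d) ℝ)) δ D n
      (fun i => θ i ω) (fun i t => ξ i t ω) ≤ B}

/-- The standing assumptions on the sizes and on `σ` and `δ`. -/
structure Admissible (d m k n : ℕ) (σ δ : ℝ) : Prop where
  d_pos : 1 ≤ d
  m_pos : 1 ≤ m
  k_pos : 1 ≤ k
  le_n : min k (d ^ 2) ≤ n
  sigma_nonneg : 0 ≤ σ
  sigma_le : σ ≤ 1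
  delta_pos : 0 < δ
  delta_lt : δ < 1

/-- The logarithmic factor, to some power of which the notation `Õ` is insensitive. -/
def logFactor (m k n : ℕ) (δ : ℝ) : ℝ := 1 + Real.log (k * m * n / δ)

end

end CPPE

/-!
Why the regret bounds hold.

**Accuracy.** If a phase plays the actions `x` of a design `π` about `β π(x) g(π)` times, the least
squares estimates of the values of all active actions are unbiased with variance at most `1 / β`
(`rate_mul_sum_lsCoeff_sq_le`); the number `β` of a phase is called its `rate`. Every value used for
elimination in phase `l` is then accurate up to `ε_l`: in a personalized phase this is a tail bound
for the noise, and in a collaborative phase one half of `ε_l` pays for the averaged noise and the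
other half, through `h ≤ ε_l / 2`, for the distance between the parameter of a user and the average
parameter (`abs_inner_phaseEst_sub_le`). Hence the best actions are never eliminated, and the
actions active in phase `l` have gap at most `8 ε_l` (`stateAt_active_spec`); in the first phase the
size of the parameters takes the place of this bound.

**Length of the phases.** By the easy half of the Kiefer–Wolfowitz theorem `g(π) ≤ d` for a
G-optimal design: weights maximizing the determinant of the information matrix already satisfy this
bound (`exists_weights_dotProduct_inv_le`). A phase thus lasts at most `d² + β d` rounds, where `β`
is of order `1 / (m ε_l²)` or `1 / ε_l²` up to logarithms. Bounding the regret of all rounds in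
phases with `ε_l ≤ η` by `η` each and summing a geometric series over the other phases gives, per
user, `η n + d² + d / (M η)` up to logarithms, with `M = m` if the phases with `ε_l > η` are all
collaborative and `M = 1` in general (`regret_le`).

**Probability.** The active sets and the rounds of a phase depend on the noise of earlier phases.
The state at the beginning of a phase takes countably many values and is determined by the
parameters and the noise of earlier rounds (`stateAt_congr`), so it is independent of the noise of
the phase that follows (`measure_stateAt_eq_and_not_goodPhase`), and the tail bound for a fixed
state can be summed over all states. The confidence `1 - δ` leaves no room: the prior event and the
noise events may fail with probability `δ / 2` each, which needs the two-sided Gaussian tail bound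
`P(|Z| > t) ≤ exp (-t² / (2 v))` without a factor `2` (`gaussianReal_abs_gt_le`).

**The regimes.** The threshold `h` is at most of order `σ`, up to logarithms. If `n s² σ² ≤ c d` with
`s² ≤ m`, then a suitable `η` of order `√(d / n) / s`, up to logarithms, exceeds `2 h`. All phases with
`ε_l > η` are then collaborative, and the total is of order `(m / s) √(d n) + m d²`
(`Admissible.regretAtMost_collab`). The first claim is the case `s = √m`, the second the case
`s = m ^ γ`. The third bound follows with `η = √(d / n)` and holds without any assumption on `σ`
(`Admissible.regretAtMost_personal`).
-/

namespace CPPE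

/-! ### Pseudo-inverses and information matrices -/

section Pinv

variable {d k : ℕ}

theorem isHermitian_pinv (A : Matrix (Fin d) (Fin d) ℝ) : (pinv A).IsHermitian :=
  IsSelfAdjoint.cfc

theorem pinv_mul_self_mul {A : Matrix (Fin d) (Fin d) ℝ} (hA : A.IsHermitian) :
    A * pinv A * A = A := by
  have hA' : IsSelfAdjoint A := hA
  have hc : ∀ f : ℝ → ℝ, ContinuousOn f (spectrum ℝ A) := fun f =>
    (Matrix.finite_real_spectrum (A := A)).continuousOn f
  have h1 : A * pinv A = cfc (fun t : ℝ => t * t⁻¹) A := by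
    rw [cfc_mul (fun t : ℝ => t) (fun t : ℝ => t⁻¹) A (hc _) (hc _), cfc_id' ℝ A]
    rfl
  have h2 : A * pinv A * A = cfc (fun t : ℝ => t * t⁻¹ * t) A := by
    rw [cfc_mul (fun t : ℝ => t * t⁻¹) (fun t : ℝ => t) A (hc _) (hc _), cfc_id' ℝ A, h1]
  rw [h2]
  have : (fun t : ℝ => t * t⁻¹ * t) = fun t => t := by
    funext t
    exact mul_inv_mul_cancel t
  rw [this, cfc_id' ℝ A]

theorem commute_pinv {A : Matrix (Fin d) (Fin d) ℝ} (hA : A.IsHermitian) :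
    A * pinv A = pinv A * A := by
  have hA' : IsSelfAdjoint A := hA
  have hc : ∀ f : ℝ → ℝ, ContinuousOn f (spectrum ℝ A) := fun f =>
    (Matrix.finite_real_spectrum (A := A)).continuousOn f
  have h1 : A * pinv A = cfc (fun t : ℝ => t * t⁻¹) A := by
    rw [cfc_mul (fun t : ℝ => t) (fun t : ℝ => t⁻¹) A (hc _) (hc _), cfc_id' ℝ A]
    rfl
  have h2 : pinv A * A = cfc (fun t : ℝ => t⁻¹ * t) A := by
    rw [cfc_mul (fun t : ℝ => t⁻¹) (fun t : ℝ => t) A (hc _) (hc _), cfc_id' ℝ A]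
    rfl
  rw [h1, h2]
  simp_rw [mul_comm]

theorem dotProduct_mulVec_symm {A : Matrix (Fin d) (Fin d) ℝ} (hA : A.IsHermitian)
    (u v : Fin d → ℝ) : u ⬝ᵥ (A *ᵥ v) = (A *ᵥ u) ⬝ᵥ v := by
  have hT : Aᵀ = A := by simpa using hA.eq
  rw [dotProduct_mulVec, ← mulVec_transpose, hT]

/-- On the range of `A` the pseudo-inverse may be replaced by any choice of a preimage. -/
theorem quad_pinv_of_mulVec_eq {A : Matrix (Fin d) (Fin d) ℝ} (hA : A.IsHermitian)
    {v : EuclideanSpace ℝ (Fin d)} {u : Fin d → ℝ} (h : A *ᵥ u = v.ofLp) :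
    quad (pinv A) v = u ⬝ᵥ (A *ᵥ u) := by
  rw [quad, ← h, mulVec_mulVec, ← dotProduct_mulVec_symm hA, mulVec_mulVec, ← mul_assoc,
    pinv_mul_self_mul hA]

theorem isHermitian_infoMatrix (a : Fin k → EuclideanSpace ℝ (Fin d)) (w : Fin k → ℝ) :
    (infoMatrix a w).IsHermitian := by
  rw [Matrix.IsHermitian, infoMatrix, conjTranspose_sum]
  refine Finset.sum_congr rfl fun x _ => ?_
  ext i j
  simp [vecMulVec_apply, mul_comm]

theorem infoMatrix_mulVec (a : Fin k → EuclideanSpace ℝ (Fin d)) (w : Fin k → ℝ)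
    (u : Fin d → ℝ) :
    infoMatrix a w *ᵥ u = ∑ x, (w x * ((a x).ofLp ⬝ᵥ u)) • (a x).ofLp := by
  rw [infoMatrix, sum_mulVec]
  refine Finset.sum_congr rfl fun x _ => ?_
  rw [smul_mulVec, vecMulVec_mulVec, mul_smul]
  simp

theorem dotProduct_infoMatrix_mulVec (a : Fin k → EuclideanSpace ℝ (Fin d)) (w : Fin k → ℝ)
    (u v : Fin d → ℝ) :
    v ⬝ᵥ (infoMatrix a w *ᵥ u) = ∑ x, w x * ((a x).ofLp ⬝ᵥ u) * ((a x).ofLp ⬝ᵥ v) := by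
  rw [infoMatrix_mulVec, dotProduct_sum]
  refine Finset.sum_congr rfl fun x _ => ?_
  rw [dotProduct_smul, smul_eq_mul, dotProduct_comm v]

theorem dotProduct_infoMatrix_mulVec_self (a : Fin k → EuclideanSpace ℝ (Fin d))
    (w : Fin k → ℝ) (u : Fin d → ℝ) :
    u ⬝ᵥ (infoMatrix a w *ᵥ u) = ∑ x, w x * ((a x).ofLp ⬝ᵥ u) ^ 2 := by
  rw [dotProduct_infoMatrix_mulVec]
  exact Finset.sum_congr rfl fun x _ => by ring

/-- Every vector with positive weight lies in the range of the information matrix. -/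
theorem infoMatrix_mulVec_pinv_of_ne_zero {a : Fin k → EuclideanSpace ℝ (Fin d)}
    {w : Fin k → ℝ} (hw : ∀ x, 0 ≤ w x) {x : Fin k} (hx : w x ≠ 0) :
    infoMatrix a w *ᵥ (pinv (infoMatrix a w) *ᵥ (a x).ofLp) = (a x).ofLp := by
  set A := infoMatrix a w with hAdef
  have hA : A.IsHermitian := isHermitian_infoMatrix a w
  have hQ : (1 - A * pinv A).IsHermitian := by
    rw [Matrix.IsHermitian, conjTranspose_sub, conjTranspose_mul, (isHermitian_pinv A).eq, hA.eq,
      commute_pinv hA, conjTranspose_one]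
  -- `1 - A A†` projects onto the kernel of `A`, on which the quadratic form of `A` vanishes.
  set z := (1 - A * pinv A) *ᵥ (a x).ofLp with hz
  have hAz : A *ᵥ ((1 - A * pinv A) *ᵥ z) = 0 := by
    rw [mulVec_mulVec, mul_sub, mul_one, commute_pinv hA, ← mul_assoc, pinv_mul_self_mul hA,
      sub_self, zero_mulVec]
  have hsum : ∑ y, w y * ((a y).ofLp ⬝ᵥ ((1 - A * pinv A) *ᵥ z)) ^ 2 = 0 := by
    rw [← dotProduct_infoMatrix_mulVec_self, ← hAdef, hAz, dotProduct_zero]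
  rw [Finset.sum_eq_zero_iff_of_nonneg fun y _ => mul_nonneg (hw y) (sq_nonneg _)] at hsum
  have h0 : (a x).ofLp ⬝ᵥ ((1 - A * pinv A) *ᵥ z) = 0 := by
    simpa [hx] using hsum x (Finset.mem_univ x)
  rw [dotProduct_mulVec_symm hQ, ← hz, dotProduct_self_eq_zero, hz, sub_mulVec, one_mulVec,
    ← mulVec_mulVec, sub_eq_zero] at h0
  exact h0.symm

/-- The span of the vectors with positive weight lies in the range of the information matrix. -/
theorem infoMatrix_mulVec_pinv_of_mem_span {a : Fin k → EuclideanSpace ℝ (Fin d)}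
    {w : Fin k → ℝ} (hw : ∀ x, 0 ≤ w x) {v : EuclideanSpace ℝ (Fin d)}
    (hv : v ∈ Submodule.span ℝ (a '' {x | w x ≠ 0})) :
    infoMatrix a w *ᵥ (pinv (infoMatrix a w) *ᵥ v.ofLp) = v.ofLp := by
  induction hv using Submodule.span_induction with
  | mem v hv =>
    obtain ⟨x, hx, rfl⟩ := hv
    exact infoMatrix_mulVec_pinv_of_ne_zero hw hx
  | zero => simp
  | add u v _ _ hu hv => simp [mulVec_add, hu, hv]
  | smul c v _ hv => simp [mulVec_smul, hv]

theorem quad_pinv_infoMatrix_nonneg {a : Fin k → EuclideanSpace ℝ (Fin d)}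
    {w : Fin k → ℝ} (hw : ∀ x, 0 ≤ w x) {v : EuclideanSpace ℝ (Fin d)}
    (hv : v ∈ Submodule.span ℝ (a '' {x | w x ≠ 0})) :
    0 ≤ quad (pinv (infoMatrix a w)) v := by
  rw [quad_pinv_of_mulVec_eq (isHermitian_infoMatrix a w)
    (infoMatrix_mulVec_pinv_of_mem_span hw hv), dotProduct_infoMatrix_mulVec_self]
  exact Finset.sum_nonneg fun x _ => mul_nonneg (hw x) (sq_nonneg _)

/-- Increasing the weights decreases the seminorm of the pseudo-inverse. -/
theorem mul_quad_pinv_infoMatrix_le {a : Fin k → EuclideanSpace ℝ (Fin d)}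
    {w N : Fin k → ℝ} {c : ℝ} (hw : ∀ x, 0 ≤ w x) (hc : 0 ≤ c) (hN : ∀ x, c * w x ≤ N x)
    (hsupp : ∀ x, w x ≠ 0 → N x ≠ 0)
    {v : EuclideanSpace ℝ (Fin d)} (hv : v ∈ Submodule.span ℝ (a '' {x | w x ≠ 0})) :
    c * quad (pinv (infoMatrix a N)) v ≤ quad (pinv (infoMatrix a w)) v := by
  have hN0 : ∀ x, 0 ≤ N x := fun x => (mul_nonneg hc (hw x)).trans (hN x)
  have hvN : v ∈ Submodule.span ℝ (a '' {x | N x ≠ 0}) :=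
    Submodule.span_mono (Set.image_mono fun x hx => hsupp x hx) hv
  have hw' := infoMatrix_mulVec_pinv_of_mem_span hw hv
  have hN' := infoMatrix_mulVec_pinv_of_mem_span hN0 hvN
  set u := pinv (infoMatrix a N) *ᵥ v.ofLp
  set z := pinv (infoMatrix a w) *ᵥ v.ofLp
  rw [quad_pinv_of_mulVec_eq (isHermitian_infoMatrix a w) hw',
    quad_pinv_of_mulVec_eq (isHermitian_infoMatrix a N) hN']
  -- expand `0 ≤ (c u - z)ᵀ V (c u - z)`, where `V z = v = A u` and `c V ≤ A`
  have h1 : c * (u ⬝ᵥ (infoMatrix a w *ᵥ u)) ≤ u ⬝ᵥ (infoMatrix a N *ᵥ u) := by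
    rw [dotProduct_infoMatrix_mulVec_self, dotProduct_infoMatrix_mulVec_self, Finset.mul_sum]
    refine Finset.sum_le_sum fun x _ => ?_
    rw [← mul_assoc]
    exact mul_le_mul_of_nonneg_right (hN x) (sq_nonneg _)
  have h2 : u ⬝ᵥ (infoMatrix a w *ᵥ z) = u ⬝ᵥ (infoMatrix a N *ᵥ u) := by rw [hw', hN']
  have h3 : z ⬝ᵥ (infoMatrix a w *ᵥ u) = u ⬝ᵥ (infoMatrix a N *ᵥ u) := by
    rw [← h2, dotProduct_mulVec_symm (isHermitian_infoMatrix a w), dotProduct_comm]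
  have h4 : 0 ≤ (c • u - z) ⬝ᵥ (infoMatrix a w *ᵥ (c • u - z)) := by
    rw [dotProduct_infoMatrix_mulVec_self]
    exact Finset.sum_nonneg fun x _ => mul_nonneg (hw x) (sq_nonneg _)
  rw [mulVec_sub, mulVec_smul, dotProduct_sub, sub_dotProduct, sub_dotProduct, smul_dotProduct,
    smul_dotProduct, dotProduct_smul, dotProduct_smul, h2, h3] at h4
  simp only [smul_eq_mul] at h4
  nlinarith [mul_le_mul_of_nonneg_left h1 hc]

end Pinv

/-! ### Existence of designs with `g ≤ d` -/

section KieferWolfowitz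

variable {d r k : ℕ}

theorem det_infoMatrix_pos {b : Fin k → EuclideanSpace ℝ (Fin r)} {w : Fin k → ℝ}
    (hw : ∀ x, 0 ≤ w x)
    (hb : ∀ u : Fin r → ℝ, (∀ x, w x ≠ 0 → (b x).ofLp ⬝ᵥ u = 0) → u = 0) :
    0 < (infoMatrix b w).det := by
  refine Matrix.PosDef.det_pos (Matrix.PosDef.of_dotProduct_mulVec_pos
    (isHermitian_infoMatrix b w) fun u hu => ?_)
  rw [star_trivial, dotProduct_infoMatrix_mulVec_self]
  refine lt_of_le_of_ne (Finset.sum_nonneg fun x _ => mul_nonneg (hw x) (sq_nonneg _)) ?_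
  intro h
  refine hu (hb u fun x hx => ?_)
  have h' := (Finset.sum_eq_zero_iff_of_nonneg
    fun x _ => mul_nonneg (hw x) (sq_nonneg _)).1 h.symm x (Finset.mem_univ x)
  simpa [hx] using h'

theorem infoMatrix_add_smul_single (b : Fin k → EuclideanSpace ℝ (Fin r)) (w : Fin k → ℝ)
    (c s : ℝ) (x : Fin k) :
    infoMatrix b (c • (w + s • Pi.single x 1))
      = c • (infoMatrix b w + s • vecMulVec (b x).ofLp (b x).ofLp) := by
  simp only [infoMatrix, Pi.smul_apply, Pi.add_apply, smul_eq_mul, mul_smul, add_smul,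
    Finset.sum_add_distrib, ← Finset.smul_sum]
  congr 2
  rw [Finset.sum_eq_single x] <;> simp +contextual

theorem det_add_smul_vecMulVec {A : Matrix (Fin r) (Fin r) ℝ} (hA : IsUnit A.det)
    (v : Fin r → ℝ) (s : ℝ) :
    (A + s • vecMulVec v v).det = A.det * (1 + s * (v ⬝ᵥ (A⁻¹ *ᵥ v))) := by
  have h1 : replicateCol Unit (s • v) * replicateRow Unit v = s • vecMulVec v v := by
    rw [← vecMulVec_eq, smul_vecMulVec]
  have h2 : A + s • vecMulVec v v
      = A * (1 + replicateCol Unit (A⁻¹ *ᵥ (s • v)) * replicateRow Unit v) := by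
    rw [mul_add, mul_one, replicateCol_mulVec, ← Matrix.mul_assoc, ← Matrix.mul_assoc,
      mul_nonsing_inv A hA,
      Matrix.one_mul, h1]
  rw [h2, det_mul, det_one_add_replicateCol_mul_replicateRow, mulVec_smul, dotProduct_smul,
    smul_eq_mul]

/-- Bernoulli's inequality read backwards. -/
theorem le_of_forall_one_add_mul_le_pow {q : ℝ}
    (h : ∀ s : ℝ, 0 < s → 1 + s * q ≤ (1 + s) ^ r) : q ≤ r := by
  have hd : HasDerivAt (fun s : ℝ => (1 + s) ^ r) r 0 := by
    have := ((hasDerivAt_id (0 : ℝ)).const_add 1).fun_pow r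
    simpa using this
  have ht := hd.tendsto_slope_zero_right
  refine ge_of_tendsto ht ?_
  filter_upwards [self_mem_nhdsWithin] with s hs
  have hs : 0 < s := hs
  have := h s hs
  simp only [zero_add, add_zero, one_pow, smul_eq_mul]
  rw [inv_mul_eq_div, le_div_iff₀ hs]
  linarith

/-- The easy half of the Kiefer–Wolfowitz theorem for a spanning family: the weights that maximize
the determinant of the information matrix satisfy `g ≤ r`. -/
theorem exists_weights_dotProduct_inv_le (b : Fin k → EuclideanSpace ℝ (Fin r))
    {S : Finset (Fin k)} (hS : S.Nonempty)
    (hb : ∀ u : Fin r → ℝ, (∀ x ∈ S, (b x).ofLp ⬝ᵥ u = 0) → u = 0) :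
    ∃ w : Fin k → ℝ, (∀ x, 0 ≤ w x) ∧ (∀ x, x ∉ S → w x = 0) ∧ ∑ x, w x = 1 ∧
      IsUnit (infoMatrix b w).det ∧
      ∀ x ∈ S, (b x).ofLp ⬝ᵥ ((infoMatrix b w)⁻¹ *ᵥ (b x).ofLp) ≤ r := by
  classical
  set K : Set (Fin k → ℝ) := stdSimplex ℝ (Fin k) ∩ {w | ∀ x, x ∉ S → w x = 0} with hK
  have hKc : IsCompact K := by
    refine (isCompact_stdSimplex ℝ (Fin k)).inter_right ?_
    simp only [Set.ofPred_forall]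
    exact isClosed_iInter fun x => isClosed_iInter fun _ =>
      isClosed_eq (continuous_apply x) continuous_const
  have hcont : Continuous fun w : Fin k → ℝ => (infoMatrix b w).det := by
    unfold infoMatrix
    fun_prop
  have hcard : (0 : ℝ) < S.card := by exact_mod_cast hS.card_pos
  set w₀ : Fin k → ℝ := fun x => if x ∈ S then (S.card : ℝ)⁻¹ else 0 with hw₀
  have hw₀K : w₀ ∈ K := by
    refine ⟨⟨fun x => ?_, ?_⟩, fun x hx => by simp [hw₀, hx]⟩
    · simp only [hw₀]; split_ifs <;> positivity
    · simp [hw₀, hcard.ne']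
  have hdet₀ : 0 < (infoMatrix b w₀).det := by
    refine det_infoMatrix_pos hw₀K.1.1 fun u hu => hb u fun x hx => hu x ?_
    simp [hw₀, hx, hcard.ne']
  obtain ⟨w, hwK, hmax⟩ := hKc.exists_isMaxOn ⟨w₀, hw₀K⟩ hcont.continuousOn
  have hdet : 0 < (infoMatrix b w).det := hdet₀.trans_le (hmax hw₀K)
  refine ⟨w, hwK.1.1, hwK.2, hwK.1.2, isUnit_iff_ne_zero.2 hdet.ne', fun x hx => ?_⟩
  refine le_of_forall_one_add_mul_le_pow fun s hs => ?_
  -- move towards the point mass at `x`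
  have hs1 : 0 < 1 + s := by linarith
  have hmem : (1 + s)⁻¹ • (w + s • Pi.single x (1 : ℝ)) ∈ K := by
    refine ⟨⟨fun y => ?_, ?_⟩, fun y hy => ?_⟩
    · have := hwK.1.1 y
      have h1 : (0 : ℝ) ≤ (Pi.single x (1 : ℝ) : Fin k → ℝ) y := by
        rw [Pi.single_apply]; split_ifs <;> norm_num
      simp only [Pi.smul_apply, Pi.add_apply, smul_eq_mul]
      positivity
    · simp only [Pi.smul_apply, Pi.add_apply, smul_eq_mul, ← Finset.mul_sum,
        Finset.sum_add_distrib, hwK.1.2]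
      simp [hs1.ne']
    · have hxy : y ≠ x := fun h => hy (h ▸ hx)
      simp [hwK.2 y hy, hxy]
  have hle : (infoMatrix b ((1 + s)⁻¹ • (w + s • Pi.single x (1 : ℝ)))).det
      ≤ (infoMatrix b w).det := hmax hmem
  rw [infoMatrix_add_smul_single, det_smul, det_add_smul_vecMulVec (isUnit_iff_ne_zero.2 hdet.ne'),
    Fintype.card_fin, inv_pow, inv_mul_le_iff₀ (by positivity), mul_comm ((1 + s) ^ r)] at hle
  exact le_of_mul_le_mul_left hle hdet

theorem real_inner_eq_dotProduct (u v : EuclideanSpace ℝ (Fin d)) :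
    ⟪u, v⟫ = u.ofLp ⬝ᵥ v.ofLp := by
  rw [EuclideanSpace.inner_eq_star_dotProduct, star_trivial, dotProduct_comm]

/-- The easy half of the Kiefer–Wolfowitz theorem: some design on `S` has `g ≤ d`. -/
theorem exists_isDesign_gValue_le (a : Fin k → EuclideanSpace ℝ (Fin d))
    {S : Finset (Fin k)} (hS : S.Nonempty) :
    ∃ w, IsDesign a S w ∧ gValue a S w ≤ d := by
  classical
  -- isometric coordinates on the span of `S`
  set W : Submodule ℝ (EuclideanSpace ℝ (Fin d)) := Submodule.span ℝ (a '' {x | x ∈ S}) with hW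
  have haW : ∀ x ∈ S, a x ∈ W := fun x hx => Submodule.subset_span ⟨x, hx, rfl⟩
  set r := Module.finrank ℝ W with hr
  let B : OrthonormalBasis (Fin r) ℝ W := stdOrthonormalBasis ℝ W
  let T : EuclideanSpace ℝ (Fin r) →ₗᵢ[ℝ] EuclideanSpace ℝ (Fin d) :=
    W.subtypeₗᵢ.comp B.repr.symm.toLinearIsometry
  have hTW : ∀ u, T u ∈ W := fun u => (B.repr.symm u).2
  have hex : ∀ x, ∃ v, x ∈ S → T v = a x := fun x => by
    by_cases hx : x ∈ S
    · exact ⟨B.repr ⟨a x, haW x hx⟩, fun _ => by simp [T]⟩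
    · exact ⟨0, fun h => absurd h hx⟩
  choose b hb using hex
  have hdot : ∀ x ∈ S, ∀ u : Fin r → ℝ, (b x).ofLp ⬝ᵥ u = ⟪a x, T (WithLp.toLp 2 u)⟫ := by
    intro x hx u
    rw [← hb x hx, T.inner_map_map, real_inner_eq_dotProduct]
  obtain ⟨w, hw0, hwS, hw1, hdet, hle⟩ := exists_weights_dotProduct_inv_le b hS (by
    intro u hu
    have h0 : ∀ v ∈ W, ⟪v, T (WithLp.toLp 2 u)⟫ = 0 := by
      intro v hv
      induction hv using Submodule.span_induction with
      | mem v hv =>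
        obtain ⟨x, hx, rfl⟩ := hv
        rw [← hdot x hx, hu x hx]
      | zero => simp
      | add u v _ _ hu hv => simp [inner_add_left, hu, hv]
      | smul c v _ hv => simp [inner_smul_left, hv]
    have h1 := inner_self_eq_zero.1 (h0 _ (hTW (WithLp.toLp 2 u)))
    have h2 : WithLp.toLp 2 u = (0 : EuclideanSpace ℝ (Fin r)) :=
      T.injective (h1.trans T.map_zero.symm)
    simpa using congrArg WithLp.ofLp h2)
  set M := infoMatrix b w with hM
  let c : Fin k → EuclideanSpace ℝ (Fin r) := fun x => WithLp.toLp 2 (M⁻¹ *ᵥ (b x).ofLp)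
  have hMc : ∀ x, M *ᵥ (c x).ofLp = (b x).ofLp := fun x => by
    simp only [c]
    rw [mulVec_mulVec, mul_nonsing_inv M hdet, one_mulVec]
  have hsum : ∀ x ∈ S, ∑ y, (w y * ((a y).ofLp ⬝ᵥ (T (c x)).ofLp)) • a y = a x := by
    intro x hx
    have h1 : ∑ y, (w y * ((b y).ofLp ⬝ᵥ (c x).ofLp)) • b y = b x := by
      apply WithLp.ofLp_injective 2
      rw [← hMc x, hM, infoMatrix_mulVec, WithLp.ofLp_sum]
      rfl
    rw [← hb x hx, ← h1, map_sum]
    refine Finset.sum_congr rfl fun y _ => ?_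
    by_cases hy : y ∈ S
    · rw [map_smul, hb y hy, hdot y hy, ← real_inner_eq_dotProduct]
    · simp [hwS y hy]
  have hVu : ∀ x ∈ S, infoMatrix a w *ᵥ (T (c x)).ofLp = (a x).ofLp := by
    intro x hx
    rw [infoMatrix_mulVec]
    conv_rhs => rw [← hsum x hx]
    rw [WithLp.ofLp_sum]
    rfl
  refine ⟨w, ⟨hw0, hwS, hw1, le_antisymm ?_ ?_⟩, ?_⟩
  · exact Submodule.span_mono (Set.image_mono fun x hx => by_contra fun h => hx (hwS x h))
  · rw [Submodule.span_le]
    rintro _ ⟨x, hx, rfl⟩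
    rw [SetLike.mem_coe, ← hsum x hx]
    refine Submodule.sum_mem _ fun y _ => ?_
    by_cases hy : w y = 0
    · simp [hy]
    · exact Submodule.smul_mem _ _ (Submodule.subset_span ⟨y, hy, rfl⟩)
  · have : Nonempty {x // x ∈ S} := hS.to_subtype
    refine ciSup_le fun x => ?_
    rw [quad_pinv_of_mulVec_eq (isHermitian_infoMatrix a w) (hVu x x.2), hVu x x.2,
      dotProduct_comm, ← real_inner_eq_dotProduct, ← hb x x.2, T.inner_map_map,
      real_inner_eq_dotProduct]
    refine (hle x x.2).trans ?_
    have : r ≤ d := by simpa using Submodule.finrank_le W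
    exact_mod_cast this

theorem IsGOptimal.gValue_le {a : Fin k → EuclideanSpace ℝ (Fin d)} {S : Finset (Fin k)}
    {w : Fin k → ℝ} (h : IsGOptimal a S w) (hS : S.Nonempty) : gValue a S w ≤ d := by
  obtain ⟨w', hw', hle⟩ := exists_isDesign_gValue_le a hS
  exact (h.2 w' hw').trans hle

theorem quad_le_gValue (a : Fin k → EuclideanSpace ℝ (Fin d)) {S : Finset (Fin k)}
    (w : Fin k → ℝ) {x : Fin k} (hx : x ∈ S) :
    quad (pinv (infoMatrix a w)) (a x) ≤ gValue a S w :=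
  le_ciSup (f := fun x : {x // x ∈ S} => quad (pinv (infoMatrix a w)) (a x))
    (Set.finite_range _).bddAbove ⟨x, hx⟩

theorem IsDesign.mem_span {a : Fin k → EuclideanSpace ℝ (Fin d)} {S : Finset (Fin k)}
    {w : Fin k → ℝ} (h : IsDesign a S w) {x : Fin k} (hx : x ∈ S) :
    a x ∈ Submodule.span ℝ (a '' {x | w x ≠ 0}) := by
  rw [h.span_eq]
  exact Submodule.subset_span ⟨x, hx, rfl⟩

theorem IsDesign.gValue_nonneg {a : Fin k → EuclideanSpace ℝ (Fin d)} {S : Finset (Fin k)}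
    {w : Fin k → ℝ} (h : IsDesign a S w) : 0 ≤ gValue a S w :=
  Real.iSup_nonneg fun x => quad_pinv_infoMatrix_nonneg h.nonneg (h.mem_span x.2)

end KieferWolfowitz

/-! ### Least squares estimates -/

section LeastSquares

variable {d k : ℕ}

/-- The coefficients with which the rewards enter the least squares estimate of `⟪v, θ⟫`. -/
noncomputable def lsCoeff (a : Fin k → EuclideanSpace ℝ (Fin d)) (L : List (Fin k))
    (v : EuclideanSpace ℝ (Fin d)) (s : Fin L.length) : ℝ :=
  (a (L.get s)).ofLp ⬝ᵥ (pinv (infoMatrix a fun x => (L.count x : ℝ)) *ᵥ v.ofLp)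

theorem sum_get_eq_sum_count (L : List (Fin k)) (f : Fin k → ℝ) :
    ∑ s : Fin L.length, f (L.get s) = ∑ x, (L.count x : ℝ) * f x := by
  have h1 : ∑ s : Fin L.length, f (L.get s) = (L.map f).sum := by
    rw [← List.sum_ofFn]
    congr 1
    conv_rhs => rw [← List.ofFn_get L, List.map_ofFn]
    rfl
  rw [h1, Finset.sum_list_map_count, ← Finset.sum_subset (Finset.subset_univ L.toFinset)]
  · simp
  · intro x _ hx
    rw [List.count_eq_zero.2 (by simpa using hx)]
    simp

theorem gram_eq_infoMatrix (a : Fin k → EuclideanSpace ℝ (Fin d)) (L : List (Fin k)) :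
    (Matrix.of fun s => (a (L.get s)).ofLp : Matrix (Fin L.length) (Fin d) ℝ)ᵀ
      * Matrix.of (fun s => (a (L.get s)).ofLp) = infoMatrix a fun x => (L.count x : ℝ) := by
  ext i j
  rw [Matrix.mul_apply, infoMatrix, Matrix.sum_apply]
  simp only [transpose_apply, of_apply, Matrix.smul_apply, vecMulVec_apply, smul_eq_mul]
  exact sum_get_eq_sum_count L fun x => (a x).ofLp i * (a x).ofLp j

theorem inner_lsEstimate (a : Fin k → EuclideanSpace ℝ (Fin d)) (L : List (Fin k))
    (y : Fin L.length → ℝ) (v : EuclideanSpace ℝ (Fin d)) :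
    ⟪v, lsEstimate a L y⟫ = ∑ s, lsCoeff a L v s * y s := by
  rw [real_inner_eq_dotProduct, lsEstimate]
  simp only [gram_eq_infoMatrix]
  rw [dotProduct_mulVec_symm (isHermitian_pinv _), dotProduct_mulVec, vecMul_transpose,
    dotProduct]
  rfl

theorem lsEstimate_add (a : Fin k → EuclideanSpace ℝ (Fin d)) (L : List (Fin k))
    (y z : Fin L.length → ℝ) :
    lsEstimate a L (fun s => y s + z s) = lsEstimate a L y + lsEstimate a L z := by
  refine ext_inner_left ℝ fun v => ?_
  rw [inner_add_right, inner_lsEstimate, inner_lsEstimate, inner_lsEstimate,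
    ← Finset.sum_add_distrib]
  exact Finset.sum_congr rfl fun s _ => mul_add _ _ _

/-- Without noise the least squares estimate is exact on the span of the played actions. -/
theorem inner_lsEstimate_inner {a : Fin k → EuclideanSpace ℝ (Fin d)} {L : List (Fin k)}
    {v : EuclideanSpace ℝ (Fin d)}
    (hv : v ∈ Submodule.span ℝ (a '' {x | (L.count x : ℝ) ≠ 0}))
    (θ : EuclideanSpace ℝ (Fin d)) :
    ⟪v, lsEstimate a L fun s => ⟪a (L.get s), θ⟫⟫ = ⟪v, θ⟫ := by
  have h := infoMatrix_mulVec_pinv_of_mem_span (fun x => Nat.cast_nonneg _) hv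
  rw [inner_lsEstimate, real_inner_eq_dotProduct v, ← h, dotProduct_comm,
    dotProduct_infoMatrix_mulVec]
  simp only [lsCoeff, real_inner_eq_dotProduct]
  rw [sum_get_eq_sum_count L fun x =>
    (a x).ofLp ⬝ᵥ (pinv (infoMatrix a fun x => (L.count x : ℝ)) *ᵥ v.ofLp) *
      ((a x).ofLp ⬝ᵥ θ.ofLp)]
  exact Finset.sum_congr rfl fun x _ => by ring

/-- The variance of the least squares estimate of `⟪v, θ⟫` under standard noise. -/
theorem sum_lsCoeff_sq {a : Fin k → EuclideanSpace ℝ (Fin d)} {L : List (Fin k)}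
    {v : EuclideanSpace ℝ (Fin d)}
    (hv : v ∈ Submodule.span ℝ (a '' {x | (L.count x : ℝ) ≠ 0})) :
    ∑ s, lsCoeff a L v s ^ 2 = quad (pinv (infoMatrix a fun x => (L.count x : ℝ))) v := by
  have h := infoMatrix_mulVec_pinv_of_mem_span (fun x => Nat.cast_nonneg _) hv
  rw [quad_pinv_of_mulVec_eq (isHermitian_infoMatrix _ _) h, dotProduct_infoMatrix_mulVec_self]
  exact sum_get_eq_sum_count L fun x =>
    ((a x).ofLp ⬝ᵥ (pinv (infoMatrix a fun x => (L.count x : ℝ)) *ᵥ v.ofLp)) ^ 2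

theorem IsDesign.le_one {a : Fin k → EuclideanSpace ℝ (Fin d)} {S : Finset (Fin k)}
    {w : Fin k → ℝ} (h : IsDesign a S w) (x : Fin k) : w x ≤ 1 := by
  rw [← h.sum_eq_one]
  exact Finset.single_le_sum (fun y _ => h.nonneg y) (Finset.mem_univ x)

/-- Playing a design `w` at least `β w(x) g(w)` times brings all variances down to `1 / β`. -/
theorem IsDesign.mul_quad_pinv_le_one {a : Fin k → EuclideanSpace ℝ (Fin d)}
    {S : Finset (Fin k)} {w N : Fin k → ℝ} {β : ℝ} (h : IsDesign a S w) (hβ : 0 ≤ β)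
    (hN : ∀ x, β * w x * gValue a S w ≤ N x) (hN0 : ∀ x, 0 ≤ N x)
    (hN1 : ∀ x, w x ≠ 0 → 1 ≤ N x) {x : Fin k} (hx : x ∈ S) :
    β * quad (pinv (infoMatrix a N)) (a x) ≤ 1 := by
  have hsupp : ∀ x, w x ≠ 0 → N x ≠ 0 := fun x hx => (zero_lt_one.trans_le (hN1 x hx)).ne'
  have hg := quad_le_gValue a w hx
  rcases h.gValue_nonneg.eq_or_lt with h0 | h0
  · have := mul_quad_pinv_infoMatrix_le (N := N) (c := 1) h.nonneg zero_le_one (fun y => by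
      by_cases hy : w y = 0
      · simpa [hy] using hN0 y
      · linarith [h.le_one y, hN1 y hy]) hsupp (h.mem_span hx)
    have h1 : quad (pinv (infoMatrix a N)) (a x) ≤ 0 := by linarith
    linarith [mul_nonpos_of_nonneg_of_nonpos hβ h1]
  · have := mul_quad_pinv_infoMatrix_le (N := N) (c := β * gValue a S w) h.nonneg (by positivity)
      (fun y => by linarith [hN y, mul_right_comm β (gValue a S w) (w y)]) hsupp (h.mem_span hx)
    refine le_of_mul_le_mul_right ?_ h0
    linarith [mul_right_comm β (gValue a S w) (quad (pinv (infoMatrix a N)) (a x))]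

end LeastSquares

/-! ### The lists of actions of a phase -/

section Phase

variable {d m k : ℕ} {a : Fin k → EuclideanSpace ℝ (Fin d)} {C : Matrix (Fin d) (Fin d) ℝ}
  {δ : ℝ} {D : Finset (Fin k) → Fin k → ℝ} {l : ℕ} {S : Finset (Fin k)}

open Classical in
/-- The factor `β` such that phase `l` plays the action `x` of a design `π` about `β π(x) g(π)`
times; each user then estimates the value of each of its active actions with variance at most
`1 / β`. -/
noncomputable def rate (m : ℕ) (a : Fin k → EuclideanSpace ℝ (Fin d))
    (C : Matrix (Fin d) (Fin d) ℝ) (δ : ℝ) (l : ℕ) : ℝ :=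
  if IsCollab m a C δ l then 8 / (m * eps l ^ 2) * Real.log (2 * k * l * (l + 1) / δ)
  else 2 / eps l ^ 2 * Real.log (2 * k * m * l * (l + 1) / δ)

theorem eps_pos (l : ℕ) : 0 < eps l := by unfold eps; positivity

theorem eps_succ (l : ℕ) : eps (l + 1) = eps l / 2 := by unfold eps; rw [pow_succ]; ring

theorem eps_anti {i j : ℕ} (h : i ≤ j) : eps j ≤ eps i :=
  pow_le_pow_of_le_one (by norm_num) (by norm_num) h

theorem one_le_div_of_delta {x : ℝ} (hx : 1 ≤ x) (hδ : 0 < δ) (hδ1 : δ < 1) : 1 ≤ x / δ := by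
  rw [le_div_iff₀ hδ]
  linarith

theorem log_collab_nonneg (hk : 1 ≤ k) (hl : 1 ≤ l) (hδ : 0 < δ) (hδ1 : δ < 1) :
    0 ≤ Real.log (2 * k * l * (l + 1) / δ) := by
  refine Real.log_nonneg (one_le_div_of_delta ?_ hδ hδ1)
  have h : 1 ≤ 2 * k * l * (l + 1) := Nat.one_le_iff_ne_zero.2 (by positivity)
  exact_mod_cast h

theorem log_personal_nonneg (hk : 1 ≤ k) (hm : 1 ≤ m) (hl : 1 ≤ l) (hδ : 0 < δ) (hδ1 : δ < 1) :
    0 ≤ Real.log (2 * k * m * l * (l + 1) / δ) := by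
  refine Real.log_nonneg (one_le_div_of_delta ?_ hδ hδ1)
  have h : 1 ≤ 2 * k * m * l * (l + 1) := Nat.one_le_iff_ne_zero.2 (by positivity)
  exact_mod_cast h

theorem rate_nonneg (hk : 1 ≤ k) (hm : 1 ≤ m) (hl : 1 ≤ l) (hδ : 0 < δ) (hδ1 : δ < 1) :
    0 ≤ rate m a C δ l := by
  have h1 := log_collab_nonneg hk hl hδ hδ1
  have h2 := log_personal_nonneg hk hm hl hδ hδ1
  unfold rate
  split_ifs <;> positivity

theorem pulls_eq (x : Fin k) :
    pulls m a C δ D l S x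
      = if D S x = 0 then 0 else max 1 ⌈rate m a C δ l * D S x * gValue a S (D S)⌉₊ := by
  unfold pulls rate
  split_ifs
  · rfl
  · congr 2
    ring
  · congr 2
    ring

theorem count_phaseList (x : Fin k) :
    (phaseList m a C δ D l S).count x = pulls m a C δ D l S x := by
  rw [phaseList, List.count_flatMap, ← Fin.sum_univ_def]
  simp [List.count_replicate]

theorem length_phaseList :
    (phaseList m a C δ D l S).length = ∑ x, pulls m a C δ D l S x := by
  rw [phaseList, List.length_flatMap, Fin.sum_univ_def]
  simp

theorem mem_phaseList {x : Fin k} (hD : IsDesignRule a D) (hS : S.Nonempty)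
    (hx : x ∈ phaseList m a C δ D l S) : x ∈ S := by
  by_contra h
  have h0 := List.count_pos_iff.2 hx
  rw [count_phaseList, pulls_eq, if_pos ((hD S hS).1.1.eq_zero x h)] at h0
  exact lt_irrefl 0 h0

theorem one_le_pulls {x : Fin k} (hx : D S x ≠ 0) : 1 ≤ pulls m a C δ D l S x := by
  rw [pulls_eq, if_neg hx]
  exact le_max_left _ _

theorem length_phaseList_pos (hD : IsDesignRule a D) (hS : S.Nonempty) :
    0 < (phaseList m a C δ D l S).length := by
  have hne : ∃ x, D S x ≠ 0 := by
    by_contra! h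
    have := (hD S hS).1.1.sum_eq_one
    simp [h] at this
  obtain ⟨x, hx⟩ := hne
  rw [length_phaseList]
  exact (one_le_pulls hx).trans (Finset.single_le_sum (fun _ _ => Nat.zero_le _)
    (Finset.mem_univ x))

theorem mem_span_count_phaseList (hD : IsDesignRule a D) {x : Fin k} (hx : x ∈ S) :
    a x ∈ Submodule.span ℝ
      (a '' {x | (((phaseList m a C δ D l S).count x : ℕ) : ℝ) ≠ 0}) := by
  refine Submodule.span_mono (Set.image_mono fun y hy => ?_) ((hD S ⟨x, hx⟩).1.1.mem_span hx)
  have := one_le_pulls (m := m) (a := a) (C := C) (δ := δ) (l := l) hy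
  simp only [Set.mem_ofPred_eq, count_phaseList]
  exact_mod_cast Nat.one_le_iff_ne_zero.1 this

/-- The variance of each user's estimate of the value of an active action is at most
`1 / rate`. -/
theorem rate_mul_sum_lsCoeff_sq_le (hD : IsDesignRule a D) {x : Fin k} (hx : x ∈ S)
    (hr : 0 ≤ rate m a C δ l) :
    rate m a C δ l * ∑ s, lsCoeff a (phaseList m a C δ D l S) (a x) s ^ 2 ≤ 1 := by
  rw [sum_lsCoeff_sq (mem_span_count_phaseList hD hx)]
  refine (hD S ⟨x, hx⟩).1.1.mul_quad_pinv_le_one hr (fun y => ?_) (fun y => Nat.cast_nonneg _)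
    (fun y hy => ?_) hx
  · rw [count_phaseList, pulls_eq]
    split_ifs with h
    · simp [h]
    · exact (Nat.le_ceil _).trans (by exact_mod_cast le_max_right _ _)
  · rw [count_phaseList]
    exact_mod_cast one_le_pulls hy

/-- By Kiefer–Wolfowitz a phase takes at most `d² + d · rate` rounds. -/
theorem length_phaseList_le (hD : IsDesignRule a D) (hS : S.Nonempty)
    (hr : 0 ≤ rate m a C δ l) :
    ((phaseList m a C δ D l S).length : ℝ) ≤ d ^ 2 + rate m a C δ l * d := by
  classical
  obtain ⟨hopt, hcard⟩ := hD S hS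
  have hg0 := hopt.1.gValue_nonneg
  have hg := hopt.gValue_le hS
  have h1 : ∀ x, (pulls m a C δ D l S x : ℝ)
      ≤ (if D S x ≠ 0 then 1 else 0) + rate m a C δ l * gValue a S (D S) * D S x := by
    intro x
    rw [pulls_eq]
    by_cases h : D S x = 0
    · simp [h]
    · have hy : 0 ≤ rate m a C δ l * D S x * gValue a S (D S) :=
        mul_nonneg (mul_nonneg hr (hopt.1.nonneg x)) hg0
      have hc := (Nat.ceil_lt_add_one hy).le
      rw [if_neg h, if_pos h, Nat.cast_max, max_le_iff]
      constructor
      · push_cast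
        nlinarith
      · nlinarith
  have h2 : (∑ x, (if D S x ≠ 0 then 1 else 0 : ℝ)) ≤ d ^ 2 := by
    rw [Finset.sum_boole]
    have h3 : {x | D S x ≠ 0}.ncard = (Finset.univ.filter fun x => D S x ≠ 0).card := by
      rw [← Set.ncard_coe_finset]
      congr 1
      ext x
      simp
    rw [h3] at hcard
    have h4 : d * (d + 1) / 2 ≤ d ^ 2 := by
      apply Nat.div_le_of_le_mul
      nlinarith [Nat.le_self_pow two_ne_zero d]
    exact_mod_cast hcard.trans h4
  rw [length_phaseList]
  push_cast
  calc ∑ x, (pulls m a C δ D l S x : ℝ)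
      ≤ ∑ x, ((if D S x ≠ 0 then 1 else 0) + rate m a C δ l * gValue a S (D S) * D S x) :=
        Finset.sum_le_sum fun x _ => h1 x
    _ = (∑ x, (if D S x ≠ 0 then 1 else 0 : ℝ)) + rate m a C δ l * gValue a S (D S) := by
        rw [Finset.sum_add_distrib, ← Finset.mul_sum, hopt.1.sum_eq_one, mul_one]
    _ ≤ d ^ 2 + rate m a C δ l * d := add_le_add h2 (mul_le_mul_of_nonneg_left hg hr)

end Phase

/-! ### The course of the algorithm on the good event -/

section Course

variable {d m k : ℕ} {a : Fin k → EuclideanSpace ℝ (Fin d)} {C : Matrix (Fin d) (Fin d) ℝ}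
  {δ : ℝ} {D : Finset (Fin k) → Fin k → ℝ}

/-- The error that the noise causes in the least squares estimate of user `i` in phase `l`, when
the phase begins in state `st`. -/
noncomputable def noiseEst (a : Fin k → EuclideanSpace ℝ (Fin d)) (C : Matrix (Fin d) (Fin d) ℝ)
    (δ : ℝ) (D : Finset (Fin k) → Fin k → ℝ) (ξ : Fin m → ℕ → ℝ) (l : ℕ) (st : PhaseState m k)
    (i : Fin m) : EuclideanSpace ℝ (Fin d) :=
  lsEstimate a (phaseList m a C δ D l (st.active i)) fun s => ξ i (st.start i + s)

/-- The least squares estimate of user `i` in phase `l`. -/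
noncomputable def ownEst (a : Fin k → EuclideanSpace ℝ (Fin d)) (C : Matrix (Fin d) (Fin d) ℝ)
    (δ : ℝ) (D : Finset (Fin k) → Fin k → ℝ) (θ : Fin m → EuclideanSpace ℝ (Fin d))
    (ξ : Fin m → ℕ → ℝ) (l : ℕ) (st : PhaseState m k) (i : Fin m) : EuclideanSpace ℝ (Fin d) :=
  lsEstimate a (phaseList m a C δ D l (st.active i)) fun s =>
    ⟪a ((phaseList m a C δ D l (st.active i)).get s), θ i⟫ + ξ i (st.start i + s)

open Classical in
/-- The vector `w_i` by which user `i` eliminates actions at the end of phase `l`. -/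
noncomputable def phaseEst (a : Fin k → EuclideanSpace ℝ (Fin d)) (C : Matrix (Fin d) (Fin d) ℝ)
    (δ : ℝ) (D : Finset (Fin k) → Fin k → ℝ) (θ : Fin m → EuclideanSpace ℝ (Fin d))
    (ξ : Fin m → ℕ → ℝ) (l : ℕ) (st : PhaseState m k) (i : Fin m) : EuclideanSpace ℝ (Fin d) :=
  if IsCollab m a C δ l then (1 / (m : ℝ)) • ∑ j, ownEst a C δ D θ ξ l st j
  else ownEst a C δ D θ ξ l st i

variable {θ : Fin m → EuclideanSpace ℝ (Fin d)} {ξ : Fin m → ℕ → ℝ} {l : ℕ}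
  {st : PhaseState m k}

theorem mem_runPhase_active {i : Fin m} {x : Fin k} :
    x ∈ (runPhase a C δ D θ ξ l st).active i ↔
      x ∈ st.active i ∧
        ∀ x' ∈ st.active i, ⟪phaseEst a C δ D θ ξ l st i, a x' - a x⟫ ≤ 2 * eps l := by
  simp only [runPhase, Finset.mem_filter]
  rfl

theorem runPhase_start (i : Fin m) :
    (runPhase a C δ D θ ξ l st).start i
      = st.start i + (phaseList m a C δ D l (st.active i)).length := rfl

theorem ownEst_eq (i : Fin m) :
    ownEst a C δ D θ ξ l st i
      = lsEstimate a (phaseList m a C δ D l (st.active i))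
          (fun s => ⟪a ((phaseList m a C δ D l (st.active i)).get s), θ i⟫)
        + noiseEst a C δ D ξ l st i :=
  lsEstimate_add _ _ _ _

theorem inner_ownEst (hD : IsDesignRule a D) {i : Fin m} {x : Fin k} (hx : x ∈ st.active i) :
    ⟪a x, ownEst a C δ D θ ξ l st i⟫ = ⟪a x, θ i⟫ + ⟪a x, noiseEst a C δ D ξ l st i⟫ := by
  rw [ownEst_eq, inner_add_right, inner_lsEstimate_inner (mem_span_count_phaseList hD hx)]

theorem runPhase_active_nonempty (hst : ∀ i, (st.active i).Nonempty) (i : Fin m) :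
    ((runPhase a C δ D θ ξ l st).active i).Nonempty := by
  obtain ⟨x, hx, hmax⟩ := (st.active i).exists_max_image
    (fun x => ⟪phaseEst a C δ D θ ξ l st i, a x⟫) (hst i)
  refine ⟨x, mem_runPhase_active.2 ⟨hx, fun x' hx' => ?_⟩⟩
  rw [inner_sub_right]
  linarith [hmax x' hx', eps_pos l]

theorem stateAt_active_nonempty (hk : 1 ≤ k) (j : ℕ) (i : Fin m) :
    ((stateAt a C δ D θ ξ j).active i).Nonempty := by
  induction j generalizing i with
  | zero => exact ⟨⟨0, hk⟩, Finset.mem_univ _⟩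
  | succ j ih => exact runPhase_active_nonempty ih i

theorem stateAt_start_succ (j : ℕ) (i : Fin m) :
    (stateAt a C δ D θ ξ (j + 1)).start i = (stateAt a C δ D θ ξ j).start i
      + (phaseList m a C δ D (j + 1) ((stateAt a C δ D θ ξ j).active i)).length := rfl

theorem le_stateAt_start (hk : 1 ≤ k) (hD : IsDesignRule a D) (j : ℕ) (i : Fin m) :
    j ≤ (stateAt a C δ D θ ξ j).start i := by
  induction j with
  | zero => exact Nat.zero_le _
  | succ j ih =>
    rw [stateAt_start_succ]
    have := length_phaseList_pos (m := m) (C := C) (δ := δ) (l := j + 1) hD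
      (stateAt_active_nonempty (a := a) (C := C) (δ := δ) (D := D) (θ := θ) (ξ := ξ) hk j i)
    omega

/-- In round `t` user `i` plays an action that is active in the phase in which the round falls. -/
theorem exists_action_eq (hk : 1 ≤ k) (hD : IsDesignRule a D) (i : Fin m) (t : ℕ) :
    ∃ j ≤ t, (stateAt a C δ D θ ξ j).start i ≤ t ∧ t < (stateAt a C δ D θ ξ (j + 1)).start i ∧
      ∃ x ∈ (stateAt a C δ D θ ξ j).active i, action a C δ D θ ξ i t = a x := by
  set j := Nat.findGreatest (fun j => (stateAt a C δ D θ ξ j).start i ≤ t) t with hj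
  have h1 : (stateAt a C δ D θ ξ j).start i ≤ t :=
    Nat.findGreatest_spec (P := fun j => (stateAt a C δ D θ ξ j).start i ≤ t)
      (Nat.zero_le t) (Nat.zero_le t)
  have h2 : t < (stateAt a C δ D θ ξ (j + 1)).start i := by
    by_contra! h
    have h3 := (le_stateAt_start hk hD (j + 1) i).trans h
    have := Nat.le_findGreatest (P := fun j => (stateAt a C δ D θ ξ j).start i ≤ t) h3 h
    omega
  refine ⟨j, Nat.findGreatest_le t, h1, h2, ?_⟩
  rw [stateAt_start_succ] at h2
  set L := phaseList m a C δ D (j + 1) ((stateAt a C δ D θ ξ j).active i) with hL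
  have h3 : t - (stateAt a C δ D θ ξ j).start i < L.length := by omega
  refine ⟨L[t - (stateAt a C δ D θ ξ j).start i],
    mem_phaseList hD (stateAt_active_nonempty hk j i) (List.getElem_mem h3), ?_⟩
  have h4 : action a C δ D θ ξ i t
      = (L.map a).getD (t - (stateAt a C δ D θ ξ j).start i) 0 := rfl
  rw [h4, List.getD_eq_getElem _ _ (by simpa using h3), List.getElem_map]

/-- The noise of phase `l` is small: in a collaborative phase the averaged estimate is within
`ε_l / 2` of its mean on all common active actions, in a personalized phase the estimate of each
user is within `ε_l` of its mean on the active actions of that user. -/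
def GoodPhase (a : Fin k → EuclideanSpace ℝ (Fin d)) (C : Matrix (Fin d) (Fin d) ℝ)
    (δ : ℝ) (D : Finset (Fin k) → Fin k → ℝ) (ξ : Fin m → ℕ → ℝ) (l : ℕ)
    (st : PhaseState m k) : Prop :=
  (IsCollab m a C δ l → ∀ x, (∀ i, x ∈ st.active i) →
    |1 / (m : ℝ) * ∑ j, ⟪a x, noiseEst a C δ D ξ l st j⟫| ≤ eps l / 2) ∧
  (¬ IsCollab m a C δ l → ∀ i, ∀ x ∈ st.active i, |⟪a x, noiseEst a C δ D ξ l st i⟫| ≤ eps l)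

/-- The deviation bound that holds for the parameters of all users simultaneously: the first
summand of the threshold `h`. -/
noncomputable def userDev (m : ℕ) (a : Fin k → EuclideanSpace ℝ (Fin d))
    (C : Matrix (Fin d) (Fin d) ℝ) (δ : ℝ) : ℝ :=
  √(2 * (⨆ x, quad C (a x)) * Real.log (4 * k * m / δ))

/-- The deviation bound for the average of the users' parameters: the second summand of the
threshold `h`. -/
noncomputable def meanDev (m : ℕ) (a : Fin k → EuclideanSpace ℝ (Fin d))
    (C : Matrix (Fin d) (Fin d) ℝ) (δ : ℝ) : ℝ :=
  √(2 / m * (⨆ x, quad C (a x)) * Real.log (4 * k / δ))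

/-- The parameters of the users and their average are close to the population mean `μ`, in the
directions of all actions. -/
def GoodPrior (a : Fin k → EuclideanSpace ℝ (Fin d)) (C : Matrix (Fin d) (Fin d) ℝ)
    (δ : ℝ) (μ : EuclideanSpace ℝ (Fin d)) (θ : Fin m → EuclideanSpace ℝ (Fin d)) : Prop :=
  (∀ i x, |⟪a x, θ i - μ⟫| ≤ userDev m a C δ) ∧
  ∀ x, |1 / (m : ℝ) * ∑ j, ⟪a x, θ j - μ⟫| ≤ meanDev m a C δ

variable {μ : EuclideanSpace ℝ (Fin d)}

/-- On the good event all estimates used in phase `l` are accurate up to `ε_l`. -/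
theorem abs_inner_phaseEst_sub_le (hm : 1 ≤ m) (hD : IsDesignRule a D)
    (hprior : GoodPrior a C δ μ θ) (hgood : GoodPhase a C δ D ξ l st)
    (hsame : IsCollab m a C δ l → ∀ i i', st.active i = st.active i') {i : Fin m} {x : Fin k}
    (hx : x ∈ st.active i) : |⟪a x, phaseEst a C δ D θ ξ l st i - θ i⟫| ≤ eps l := by
  by_cases hc : IsCollab m a C δ l
  · have hall : ∀ j, x ∈ st.active j := fun j => hsame hc i j ▸ hx
    have hm0 : (m : ℝ) ≠ 0 := by positivity
    have h1 := hgood.1 hc x hall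
    have h2 := hprior.1 i x
    have h3 := hprior.2 x
    have h4 : userDev m a C δ + meanDev m a C δ ≤ eps l / 2 := hc
    have h5 : ⟪a x, phaseEst a C δ D θ ξ l st i - θ i⟫
        = 1 / (m : ℝ) * ∑ j, ⟪a x, θ j - μ⟫
          + 1 / (m : ℝ) * ∑ j, ⟪a x, noiseEst a C δ D ξ l st j⟫ - ⟪a x, θ i - μ⟫ := by
      simp only [inner_sub_right, phaseEst, if_pos hc, inner_smul_right, inner_sum,
        inner_ownEst hD (hall _), Finset.sum_add_distrib, Finset.sum_sub_distrib,
        Finset.sum_const, Finset.card_univ, Fintype.card_fin, nsmul_eq_mul]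
      field_simp
      ring
    rw [h5]
    rw [abs_le] at *
    constructor <;> linarith
  · rw [inner_sub_right, phaseEst, if_neg hc, inner_ownEst hD hx, add_sub_cancel_left]
    exact hgood.2 hc i x hx

theorem IsCollab.mono {i j : ℕ} (h : IsCollab m a C δ j) (hij : i ≤ j) : IsCollab m a C δ i := by
  have := eps_anti hij
  unfold IsCollab at *
  linarith

theorem stateAt_active_eq_of_isCollab {j : ℕ} (hc : IsCollab m a C δ j) (i i' : Fin m) :
    (stateAt a C δ D θ ξ j).active i = (stateAt a C δ D θ ξ j).active i' := by
  induction j with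
  | zero => rfl
  | succ j ih =>
    have h := ih (hc.mono (Nat.le_succ j))
    ext x
    simp only [stateAt, mem_runPhase_active, phaseEst, if_pos hc, h]

/-- On the good event the best actions are never eliminated, and the actions that survive phase
`j` have gap at most `4 ε_j`. -/
theorem stateAt_active_spec (hm : 1 ≤ m) (hD : IsDesignRule a D)
    (hprior : GoodPrior a C δ μ θ) {j : ℕ}
    (hgood : ∀ j' < j, GoodPhase a C δ D ξ (j' + 1) (stateAt a C δ D θ ξ j'))
    {i : Fin m} {y : Fin k} (hy : ∀ x, ⟪a x, θ i⟫ ≤ ⟪a y, θ i⟫) :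
    y ∈ (stateAt a C δ D θ ξ j).active i ∧
      (0 < j → ∀ x ∈ (stateAt a C δ D θ ξ j).active i, ⟪a y - a x, θ i⟫ ≤ 4 * eps j) := by
  induction j with
  | zero => exact ⟨Finset.mem_univ _, fun h => absurd h (lt_irrefl _)⟩
  | succ j ih =>
    have hyj := (ih fun j' hj' => hgood j' (hj'.trans (Nat.lt_succ_self j))).1
    have herr : ∀ x ∈ (stateAt a C δ D θ ξ j).active i, |⟪a x,
        phaseEst a C δ D θ ξ (j + 1) (stateAt a C δ D θ ξ j) i - θ i⟫| ≤ eps (j + 1) :=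
      fun x hx => abs_inner_phaseEst_sub_le hm hD hprior (hgood j (Nat.lt_succ_self j))
        (fun hc i i' => stateAt_active_eq_of_isCollab (hc.mono (Nat.le_succ j)) i i') hx
    have herr' : ∀ x ∈ (stateAt a C δ D θ ξ j).active i, ∀ x' ∈ (stateAt a C δ D θ ξ j).active i,
        ⟪phaseEst a C δ D θ ξ (j + 1) (stateAt a C δ D θ ξ j) i, a x - a x'⟫
          ≤ ⟪a x - a x', θ i⟫ + 2 * eps (j + 1) := by
      intro x hx x' hx'
      have h1 := (abs_le.1 (herr x hx)).2
      have h2 := (abs_le.1 (herr x' hx')).1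
      rw [real_inner_comm, inner_sub_left, inner_sub_left]
      rw [inner_sub_right] at h1 h2
      linarith
    refine ⟨mem_runPhase_active.2 ⟨hyj, fun x hx => ?_⟩, fun _ x hx => ?_⟩
    · refine (herr' x hx y hyj).trans ?_
      rw [inner_sub_left]
      linarith [hy x]
    · obtain ⟨hx1, hx2⟩ := mem_runPhase_active.1 hx
      have h1 := hx2 y hyj
      have h2 := herr' x hx1 y hyj
      rw [← neg_sub (a y) (a x), inner_neg_right, inner_neg_left] at h2
      linarith

end Course

/-! ### The regret of one user on the good event -/

section Regret

variable {d m k : ℕ} {a : Fin k → EuclideanSpace ℝ (Fin d)} {C : Matrix (Fin d) (Fin d) ℝ}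
  {δ : ℝ} {D : Finset (Fin k) → Fin k → ℝ} {θ : Fin m → EuclideanSpace ℝ (Fin d)}
  {ξ : Fin m → ℕ → ℝ} {μ : EuclideanSpace ℝ (Fin d)}

theorem sum_eps_succ_le_one (n : ℕ) : ∑ j ∈ Finset.range n, eps (j + 1) ≤ 1 := by
  have h : ∑ j ∈ Finset.range n, eps (j + 1) = 1 - eps n := by
    induction n with
    | zero => simp [eps]
    | succ n ih => rw [Finset.sum_range_succ, ih, eps_succ]; ring
  linarith [eps_pos n]

open Classical in
/-- The geometric sum of `1 / ε_l` over the phases with `ε_l > η` is dominated by its last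
term. -/
theorem sum_inv_eps_le {η : ℝ} (hη : 0 < η) (n : ℕ) :
    ∑ j ∈ Finset.range n, (if η < eps (j + 1) then (eps (j + 1))⁻¹ else 0) ≤ 2 / η := by
  have h : ∀ n, ∑ j ∈ Finset.range n, (if η < eps (j + 1) then (eps (j + 1))⁻¹ else 0)
      ≤ 2 / η ∧
      ∑ j ∈ Finset.range n, (if η < eps (j + 1) then (eps (j + 1))⁻¹ else 0)
        ≤ 2 * (eps n)⁻¹ := by
    intro n
    induction n with
    | zero => simp [eps]; positivity
    | succ n ih =>
      rw [Finset.sum_range_succ]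
      have h2 : (eps (n + 1))⁻¹ = 2 * (eps n)⁻¹ := by rw [eps_succ, inv_div, div_eq_mul_inv]
      have h3 := inv_pos.2 (eps_pos n)
      split_ifs with h
      · have h4 : (eps (n + 1))⁻¹ ≤ 1 / η := by
          rw [one_div]
          exact inv_anti₀ hη h.le
        have h5 : 2 / η = 2 * (1 / η) := by ring
        constructor <;> linarith [ih.2]
      · constructor <;> linarith [ih.1, ih.2]
  exact (h n).1

open Classical in
/-- The regret of a user whose active actions have gap at most `G ε_l` in phase `l`, if the phases
with `ε_l > η` are played with rate at most `ρ / ε_l²`. The rounds of the other phases cost at most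
`G η` each. -/
theorem sum_gap_le (hk : 1 ≤ k) (hD : IsDesignRule a D) {G η ρ : ℝ} (hG : 0 ≤ G) (hη : 0 < η)
    (hρ : 0 ≤ ρ) {n : ℕ} (i : Fin m) {f : EuclideanSpace ℝ (Fin d) → ℝ}
    (hgap : ∀ j < n, ∀ x ∈ (stateAt a C δ D θ ξ j).active i, f (a x) ≤ G * eps (j + 1))
    (hrate0 : ∀ j < n, 0 ≤ rate m a C δ (j + 1))
    (hrate : ∀ j < n, η < eps (j + 1) → rate m a C δ (j + 1) ≤ ρ / eps (j + 1) ^ 2) :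
    ∑ t ∈ Finset.range n, f (action a C δ D θ ξ i t)
      ≤ G * (η * n + d ^ 2 + 2 * ρ * d / η) := by
  set s : ℕ → ℕ := fun j => (stateAt a C δ D θ ξ j).start i with hs
  have hround : ∀ t ∈ Finset.range n, f (action a C δ D θ ξ i t) ≤ G * η +
      ∑ j ∈ Finset.range n,
        if t ∈ Finset.Ico (s j) (s (j + 1)) then
          (if η < eps (j + 1) then G * eps (j + 1) else 0) else 0 := by
    intro t ht
    rw [Finset.mem_range] at ht
    obtain ⟨j, hjt, h1, h2, x, hx, hax⟩ :=
      exists_action_eq (C := C) (δ := δ) (θ := θ) (ξ := ξ) hk hD i t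
    have hjn : j < n := hjt.trans_lt ht
    have hG' : ∀ j, 0 ≤ G * eps j := fun j => mul_nonneg hG (eps_pos j).le
    have hle : (if η < eps (j + 1) then G * eps (j + 1) else 0) ≤ ∑ j ∈ Finset.range n,
        if t ∈ Finset.Ico (s j) (s (j + 1)) then
          (if η < eps (j + 1) then G * eps (j + 1) else 0) else 0 := by
      refine le_trans (le_of_eq ?_) (Finset.single_le_sum (fun j' _ => ?_)
        (Finset.mem_range.2 hjn))
      · rw [if_pos (Finset.mem_Ico.2 ⟨h1, h2⟩)]
      · split_ifs
        exacts [hG' _, le_rfl, le_rfl]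
    rw [hax]
    refine (hgap j hjn x hx).trans ?_
    by_cases h : η < eps (j + 1)
    · rw [if_pos h] at hle
      linarith [mul_nonneg hG hη.le]
    · rw [if_neg h] at hle
      linarith [mul_le_mul_of_nonneg_left (not_lt.1 h) hG]
  have hphase : ∀ j ∈ Finset.range n, (∑ t ∈ Finset.range n,
      if t ∈ Finset.Ico (s j) (s (j + 1)) then
        (if η < eps (j + 1) then G * eps (j + 1) else 0) else 0)
      ≤ G * (d ^ 2 * eps (j + 1)
          + ρ * d * (if η < eps (j + 1) then (eps (j + 1))⁻¹ else 0)) := by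
    intro j hj
    have hjn := Finset.mem_range.1 hj
    have he := eps_pos (j + 1)
    by_cases h : η < eps (j + 1)
    · simp only [if_pos h]
      rw [← Finset.sum_filter, Finset.sum_const, nsmul_eq_mul]
      have hcard : ((Finset.range n).filter fun t => t ∈ Finset.Ico (s j) (s (j + 1))).card
          ≤ (phaseList m a C δ D (j + 1) ((stateAt a C δ D θ ξ j).active i)).length := by
        refine (Finset.card_le_card (t := Finset.Ico (s j) (s (j + 1)))
          fun t ht => (Finset.mem_filter.1 ht).2).trans ?_
        rw [Nat.card_Ico, hs]
        simp only [stateAt_start_succ]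
        omega
      have hlen := length_phaseList_le (m := m) (C := C) (δ := δ) (l := j + 1) hD
        (stateAt_active_nonempty (a := a) (C := C) (δ := δ) (D := D) (θ := θ) (ξ := ξ) hk j i)
        (hrate0 j hjn)
      have h1 : (((Finset.range n).filter fun t => t ∈ Finset.Ico (s j) (s (j + 1))).card : ℝ)
          ≤ d ^ 2 + ρ / eps (j + 1) ^ 2 * d := by
        refine le_trans (by exact_mod_cast hcard) (hlen.trans ?_)
        exact add_le_add le_rfl (mul_le_mul_of_nonneg_right (hrate j hjn h) (Nat.cast_nonneg d))
      refine (mul_le_mul_of_nonneg_right h1 (mul_nonneg hG he.le)).trans (le_of_eq ?_)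
      field_simp
    · simp only [if_neg h, ite_self, Finset.sum_const_zero, mul_zero, add_zero]
      positivity
  calc ∑ t ∈ Finset.range n, f (action a C δ D θ ξ i t)
      ≤ ∑ t ∈ Finset.range n, (G * η + ∑ j ∈ Finset.range n,
        if t ∈ Finset.Ico (s j) (s (j + 1)) then
          (if η < eps (j + 1) then G * eps (j + 1) else 0) else 0) := Finset.sum_le_sum hround
    _ = n * (G * η) + ∑ j ∈ Finset.range n, ∑ t ∈ Finset.range n,
        (if t ∈ Finset.Ico (s j) (s (j + 1)) then
          (if η < eps (j + 1) then G * eps (j + 1) else 0) else 0) := by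
        rw [Finset.sum_add_distrib, Finset.sum_comm]
        simp
    _ ≤ n * (G * η) + ∑ j ∈ Finset.range n, G * (d ^ 2 * eps (j + 1)
          + ρ * d * (if η < eps (j + 1) then (eps (j + 1))⁻¹ else 0)) :=
        add_le_add le_rfl (Finset.sum_le_sum hphase)
    _ = G * (η * n + d ^ 2 * ∑ j ∈ Finset.range n, eps (j + 1)
          + ρ * d * ∑ j ∈ Finset.range n,
            (if η < eps (j + 1) then (eps (j + 1))⁻¹ else 0)) := by
        rw [← Finset.mul_sum, Finset.sum_add_distrib, ← Finset.mul_sum, ← Finset.mul_sum]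
        ring
    _ ≤ G * (η * n + d ^ 2 * 1 + ρ * d * (2 / η)) := by
        refine mul_le_mul_of_nonneg_left ?_ hG
        refine add_le_add (add_le_add le_rfl ?_) ?_
        · exact mul_le_mul_of_nonneg_left (sum_eps_succ_le_one n) (by positivity)
        · exact mul_le_mul_of_nonneg_left (sum_inv_eps_le hη n) (by positivity)
    _ = G * (η * n + d ^ 2 + 2 * ρ * d / η) := by ring

/-- The joint regret on the good event. -/
theorem regret_le (hk : 1 ≤ k) (hm : 1 ≤ m) (ha : ∀ x, ‖a x‖ ≤ 1) (hD : IsDesignRule a D)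
    (hμ : ‖μ‖ ≤ 1) {n : ℕ} (hprior : GoodPrior a C δ μ θ)
    (hgood : ∀ j < n, GoodPhase a C δ D ξ (j + 1) (stateAt a C δ D θ ξ j))
    {η ρ : ℝ} (hη : 0 < η) (hρ : 0 ≤ ρ)
    (hrate0 : ∀ j < n, 0 ≤ rate m a C δ (j + 1))
    (hrate : ∀ j < n, η < eps (j + 1) → rate m a C δ (j + 1) ≤ ρ / eps (j + 1) ^ 2) :
    regret a C δ D n θ ξ
      ≤ m * ((8 + 4 * userDev m a C δ) * (η * n + d ^ 2 + 2 * ρ * d / η)) := by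
  have hdev : 0 ≤ userDev m a C δ := Real.sqrt_nonneg _
  have huser : ∀ i : Fin m, ∑ t ∈ Finset.range n,
      ((⨆ x, ⟪a x, θ i⟫) - ⟪action a C δ D θ ξ i t, θ i⟫)
        ≤ (8 + 4 * userDev m a C δ) * (η * n + d ^ 2 + 2 * ρ * d / η) := by
    intro i
    have : Nonempty (Fin k) := ⟨⟨0, hk⟩⟩
    obtain ⟨y, hy⟩ := exists_eq_ciSup_of_finite (f := fun x => ⟪a x, θ i⟫)
    have hbest : ∀ x, ⟪a x, θ i⟫ ≤ ⟪a y, θ i⟫ := fun x => by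
      rw [hy]
      exact le_ciSup (f := fun x => ⟪a x, θ i⟫) (Set.finite_range _).bddAbove x
    refine sum_gap_le (f := fun v => (⨆ x, ⟪a x, θ i⟫) - ⟪v, θ i⟫) hk hD (by positivity) hη hρ i
      (fun j hj x hx => ?_) hrate0 hrate
    rw [← hy, ← inner_sub_left]
    rcases Nat.eq_zero_or_pos j with rfl | hj0
    · -- in the first phase the gaps are bounded by the size of the parameters
      have h1 := (abs_le.1 (hprior.1 i x)).1
      have h2 := (abs_le.1 (hprior.1 i y)).2
      have h3 : ⟪a y - a x, μ⟫ ≤ 2 := by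
        refine (real_inner_le_norm _ _).trans ?_
        have h4 : ‖a y - a x‖ ≤ 2 := (norm_sub_le _ _).trans (by linarith [ha x, ha y])
        nlinarith [norm_nonneg (a y - a x), norm_nonneg μ]
      have h5 : eps (0 + 1) = 1 / 2 := by simp [eps]
      rw [inner_sub_left] at h3 ⊢
      rw [inner_sub_right] at h1 h2
      rw [h5]
      linarith
    · have h1 := (stateAt_active_spec hm hD hprior
        (fun j' hj' => hgood j' (hj'.trans hj)) hbest).2 hj0 x hx
      rw [eps_succ]
      nlinarith [eps_pos j]
  calc regret a C δ D n θ ξ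
      ≤ ∑ _i : Fin m, (8 + 4 * userDev m a C δ) * (η * n + d ^ 2 + 2 * ρ * d / η) :=
        Finset.sum_le_sum fun i _ => huser i
    _ = _ := by simp

end Regret

/-! ### Gaussian tail bounds -/

section Tail

open scoped ENNReal NNReal

theorem gaussianReal_Ioi_le {v : ℝ≥0} (hv : v ≠ 0) {t : ℝ} (ht : 0 ≤ t) :
    gaussianReal 0 v (Set.Ioi t)
      ≤ ENNReal.ofReal (Real.exp (-(t ^ 2 / (2 * v)))) * gaussianReal 0 v (Set.Ioi 0) := by
  have h1 : gaussianReal 0 v (Set.Ioi t) = gaussianReal (-t) v (Set.Ioi 0) := by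
    rw [← zero_sub t, ← gaussianReal_map_sub_const t, Measure.map_apply (by fun_prop)
      measurableSet_Ioi]
    congr 1
    ext x
    simp
  rw [h1, gaussianReal_apply _ hv, gaussianReal_apply _ hv,
    ← lintegral_const_mul _ (measurable_gaussianPDF 0 v)]
  refine setLIntegral_mono ((measurable_gaussianPDF 0 v).const_mul _) fun x hx => ?_
  have hx : 0 < x := hx
  have hv0 : (0 : ℝ) < v := by positivity
  rw [gaussianPDF, gaussianPDF, ← ENNReal.ofReal_mul (Real.exp_pos _).le]
  refine ENNReal.ofReal_le_ofReal ?_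
  rw [gaussianPDFReal, gaussianPDFReal, mul_left_comm, ← Real.exp_add]
  refine mul_le_mul_of_nonneg_left (Real.exp_le_exp.2 ?_) (by positivity)
  rw [neg_div, neg_div, ← neg_add, neg_le_neg_iff, ← add_div]
  gcongr
  nlinarith

/-- The two-sided Gaussian tail bound with constant `1`. -/
theorem gaussianReal_abs_gt_le (v : ℝ≥0) {t L : ℝ} (ht : 0 ≤ t) (h : 2 * v * L ≤ t ^ 2) :
    gaussianReal 0 v {x | t < |x|} ≤ ENNReal.ofReal (Real.exp (-L)) := by
  rcases eq_or_ne v 0 with rfl | hv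
  · rw [gaussianReal_zero_var, Measure.dirac_apply' _ (measurableSet_lt measurable_const
      measurable_abs)]
    simp [ht]
  have hv0 : (0 : ℝ) < v := by positivity
  have hset : {x : ℝ | t < |x|} = Set.Ioi t ∪ Set.Iio (-t) := by
    ext x
    simp [lt_abs, lt_neg]
  have hsymm : ∀ s : ℝ, gaussianReal 0 v (Set.Iio (-s)) = gaussianReal 0 v (Set.Ioi s) := by
    intro s
    conv_rhs => rw [← neg_zero, ← gaussianReal_map_neg, Measure.map_apply (by fun_prop)
      measurableSet_Ioi]
    congr 1
    ext x
    simp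
  have hhalf : gaussianReal 0 v (Set.Ioi 0) + gaussianReal 0 v (Set.Ioi 0) ≤ 1 := by
    nth_rewrite 2 [← hsymm 0]
    rw [neg_zero, ← measure_union (by simp) measurableSet_Iio]
    exact prob_le_one
  calc gaussianReal 0 v {x | t < |x|}
      ≤ gaussianReal 0 v (Set.Ioi t) + gaussianReal 0 v (Set.Iio (-t)) := by
        rw [hset]
        exact measure_union_le _ _
    _ ≤ ENNReal.ofReal (Real.exp (-(t ^ 2 / (2 * v))))
          * (gaussianReal 0 v (Set.Ioi 0) + gaussianReal 0 v (Set.Ioi 0)) := by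
        rw [hsymm, mul_add]
        exact add_le_add (gaussianReal_Ioi_le hv ht) (gaussianReal_Ioi_le hv ht)
    _ ≤ ENNReal.ofReal (Real.exp (-(t ^ 2 / (2 * v)))) * 1 := by gcongr
    _ ≤ ENNReal.ofReal (Real.exp (-L)) := by
        rw [mul_one]
        refine ENNReal.ofReal_le_ofReal (Real.exp_le_exp.2 (neg_le_neg ?_))
        rw [le_div_iff₀ (by positivity)]
        linarith

variable {Ω : Type*} [MeasurableSpace Ω] {P : Measure Ω}

theorem measure_abs_gt_le_of_hasGaussianLaw {Z : Ω → ℝ} (hZ : HasGaussianLaw Z P)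
    (hmean : ∫ ω, Z ω ∂P = 0) {V t L : ℝ} (hvar : Var[Z; P] ≤ V) (hL : 0 ≤ L) (ht : 0 ≤ t)
    (h : 2 * V * L ≤ t ^ 2) : P {ω | t < |Z ω|} ≤ ENNReal.ofReal (Real.exp (-L)) := by
  have hlaw := hZ.map_eq_gaussianReal
  rw [hmean] at hlaw
  have hm : MeasurableSet {x : ℝ | t < |x|} := measurableSet_lt measurable_const measurable_abs
  have h1 : P {ω | t < |Z ω|} = P.map Z {x | t < |x|} := by
    rw [Measure.map_apply_of_aemeasurable hZ.aemeasurable hm]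
    rfl
  rw [h1, hlaw]
  refine gaussianReal_abs_gt_le _ ht (le_trans ?_ h)
  rw [Real.coe_toNNReal _ (variance_nonneg _ _)]
  gcongr

/-- Tail bound for linear combinations of independent centred Gaussian variables. -/
theorem measure_abs_sum_gt_le {ι : Type*} [Fintype ι] {X : ι → Ω → ℝ}
    (hX : ∀ i, HasGaussianLaw (X i) P) (hmean : ∀ i, ∫ ω, X i ω ∂P = 0) {v : ℝ}
    (hvar : ∀ i, Var[X i; P] ≤ v) (hind : iIndepFun X P) (c : ι → ℝ) {t L : ℝ} (hL : 0 ≤ L)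
    (ht : 0 ≤ t) (h : 2 * (v * ∑ i, c i ^ 2) * L ≤ t ^ 2) :
    P {ω | t < |∑ i, c i * X i ω|} ≤ ENNReal.ofReal (Real.exp (-L)) := by
  have hY : ∀ i, HasGaussianLaw (fun ω => c i * X i ω) P := fun i => by
    simpa using (hX i).fun_smul (c i)
  have hYind : iIndepFun (fun i ω => c i * X i ω) P :=
    hind.comp (fun i x => c i * x) fun i => measurable_const_mul (c i)
  refine measure_abs_gt_le_of_hasGaussianLaw (iIndepFun.hasGaussianLaw_fun_sum hY hYind) ?_
    (V := v * ∑ i, c i ^ 2) ?_ hL ht h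
  · rw [integral_finsetSum _ fun i _ => (hY i).integrable]
    simp [integral_const_mul, hmean]
  · have h1 : (fun ω => ∑ i, c i * X i ω) = ∑ i, fun ω => c i * X i ω := by
      ext ω
      simp
    rw [h1, IndepFun.variance_sum (fun i _ => (hY i).memLp_two)
      (fun i _ j _ hij => hYind.indepFun hij), Finset.mul_sum]
    refine Finset.sum_le_sum fun i _ => ?_
    rw [variance_const_mul, mul_comm v]
    exact mul_le_mul_of_nonneg_left (hvar i) (sq_nonneg _)

end Tail

/-! ### The prior event -/

section Prior

variable {d m k : ℕ} {Ω : Type*} [MeasurableSpace Ω] {P : Measure Ω}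
  {C : Matrix (Fin d) (Fin d) ℝ} {μ : EuclideanSpace ℝ (Fin d)}

theorem hasLaw_inner_sub {Θ : Ω → EuclideanSpace ℝ (Fin d)} (hC : C.PosSemidef)
    (hΘ : HasLaw Θ (multivariateGaussian μ C) P) (v : EuclideanSpace ℝ (Fin d)) :
    HasLaw (fun ω => ⟪v, Θ ω - μ⟫) (gaussianReal 0 (quad C v).toNNReal) P := by
  have hid : MemLp id 2 (multivariateGaussian μ C) := IsGaussian.memLp_two_id
  have h1 : HasLaw (fun x => ⟪v, x⟫) (gaussianReal ⟪v, μ⟫ (quad C v).toNNReal)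
      (multivariateGaussian μ C) := by
    refine ⟨by fun_prop, ?_⟩
    have h2 := IsGaussian.map_eq_gaussianReal (μ := multivariateGaussian μ C) (innerSL ℝ v)
    have h3 : Var[innerSL ℝ v; multivariateGaussian μ C] = quad C v := by
      rw [quad, ← covarianceBilin_multivariateGaussian (μ := μ) hC, covarianceBilin_self hid]
      rfl
    have h4 : ∫ x, innerSL ℝ v x ∂(multivariateGaussian μ C) = ⟪v, μ⟫ := by
      rw [ContinuousLinearMap.integral_comp_id_comm IsGaussian.integrable_id,
        integral_id_multivariateGaussian]
      rfl
    rw [h3, h4] at h2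
    exact h2
  have h5 := gaussianReal_sub_const (h1.comp hΘ) ⟪v, μ⟫
  rw [sub_self] at h5
  refine h5.congr (Filter.Eventually.of_forall fun ω => ?_)
  simp [inner_sub_right]

theorem measure_not_goodPrior_le {a : Fin k → EuclideanSpace ℝ (Fin d)} {δ : ℝ}
    {θ : Fin m → Ω → EuclideanSpace ℝ (Fin d)} (hC : C.PosSemidef) (hk : 1 ≤ k) (hm : 1 ≤ m)
    (hδ : 0 < δ) (hδ1 : δ < 1) (hθ : ∀ i, HasLaw (θ i) (multivariateGaussian μ C) P)
    (hind : iIndepFun θ P) :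
    P {ω | ¬ GoodPrior a C δ μ fun i => θ i ω} ≤ ENNReal.ofReal (δ / 2) := by
  have hlaw : ∀ x i, HasLaw (fun ω => ⟪a x, θ i ω - μ⟫)
      (gaussianReal 0 (quad C (a x)).toNNReal) P := fun x i => hasLaw_inner_sub hC (hθ i) (a x)
  have hq : ∀ x, 0 ≤ quad C (a x) := fun x => by
    have := hC.dotProduct_mulVec_nonneg (a x).ofLp
    simpa [quad] using this
  have hqM : ∀ x, quad C (a x) ≤ ⨆ x, quad C (a x) := fun x =>
    le_ciSup (f := fun x => quad C (a x)) (Set.finite_range _).bddAbove x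
  have hM : 0 ≤ ⨆ x, quad C (a x) := Real.iSup_nonneg hq
  have hgauss : ∀ x i, HasGaussianLaw (fun ω => ⟪a x, θ i ω - μ⟫) P := fun x i =>
    (hlaw x i).hasGaussianLaw
  have hmean : ∀ x i, ∫ ω, ⟪a x, θ i ω - μ⟫ ∂P = 0 := fun x i => by
    rw [(hlaw x i).integral_eq, integral_id_gaussianReal]
  have hvar : ∀ x i, Var[fun ω => ⟪a x, θ i ω - μ⟫; P] ≤ ⨆ x, quad C (a x) := fun x i => by
    rw [(hlaw x i).variance_eq, variance_id_gaussianReal, Real.coe_toNNReal _ (hq x)]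
    exact hqM x
  have hm0 : (0 : ℝ) < m := by exact_mod_cast hm
  have hk0 : (0 : ℝ) < k := by exact_mod_cast hk
  have hlog1 : 0 ≤ Real.log (4 * k * m / δ) := by
    refine Real.log_nonneg (one_le_div_of_delta ?_ hδ hδ1)
    exact_mod_cast (Nat.one_le_iff_ne_zero.2 (by positivity) : 1 ≤ 4 * k * m)
  have hlog2 : 0 ≤ Real.log (4 * k / δ) := by
    refine Real.log_nonneg (one_le_div_of_delta ?_ hδ hδ1)
    exact_mod_cast (Nat.one_le_iff_ne_zero.2 (by positivity) : 1 ≤ 4 * k)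
  have huser : ∀ i x, P {ω | userDev m a C δ < |⟪a x, θ i ω - μ⟫|}
      ≤ ENNReal.ofReal (δ / (4 * k * m)) := by
    intro i x
    refine (measure_abs_gt_le_of_hasGaussianLaw (hgauss x i) (hmean x i) (hvar x i) hlog1 (Real.sqrt_nonneg _)
      (le_of_eq ?_)).trans (le_of_eq ?_)
    · rw [Real.sq_sqrt (by positivity)]
    · rw [← Real.log_inv, Real.exp_log (by positivity), inv_div]
  have hmeanDev : ∀ x, P {ω | meanDev m a C δ < |1 / (m : ℝ) * ∑ j, ⟪a x, θ j ω - μ⟫|}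
      ≤ ENNReal.ofReal (δ / (4 * k)) := by
    intro x
    have hi : iIndepFun (fun i ω => ⟪a x, θ i ω - μ⟫) P :=
      hind.comp (fun _ y => ⟪a x, y - μ⟫) fun _ => by fun_prop
    simp only [Finset.mul_sum]
    refine (measure_abs_sum_gt_le (hgauss x) (hmean x) (hvar x) hi (fun _ => 1 / (m : ℝ)) hlog2
      (Real.sqrt_nonneg _) (le_of_eq ?_)).trans (le_of_eq ?_)
    · rw [Real.sq_sqrt (by positivity)]
      simp only [Finset.sum_const, Finset.card_univ, Fintype.card_fin, nsmul_eq_mul]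
      field_simp
    · rw [← Real.log_inv, Real.exp_log (by positivity), inv_div]
  have hsub : {ω | ¬ GoodPrior a C δ μ fun i => θ i ω}
      ⊆ (⋃ q : Fin m × Fin k, {ω | userDev m a C δ < |⟪a q.2, θ q.1 ω - μ⟫|}) ∪
        ⋃ x, {ω | meanDev m a C δ < |1 / (m : ℝ) * ∑ j, ⟪a x, θ j ω - μ⟫|} := by
    intro ω hω
    by_contra h
    simp only [Set.mem_union, Set.mem_iUnion, Set.mem_ofPred_eq, not_or, not_exists, not_lt] at h
    exact hω ⟨fun i x => h.1 (i, x), h.2⟩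
  calc P {ω | ¬ GoodPrior a C δ μ fun i => θ i ω}
      ≤ ∑ _q : Fin m × Fin k, ENNReal.ofReal (δ / (4 * k * m))
        + ∑ _x : Fin k, ENNReal.ofReal (δ / (4 * k)) := by
        refine (measure_mono hsub).trans ((measure_union_le _ _).trans (add_le_add ?_ ?_))
        · exact (measure_iUnion_fintype_le _ _).trans (Finset.sum_le_sum fun q _ => huser q.1 q.2)
        · exact (measure_iUnion_fintype_le _ _).trans (Finset.sum_le_sum fun x _ => hmeanDev x)
    _ = ENNReal.ofReal (δ / 2) := by
        rw [← ENNReal.ofReal_sum_of_nonneg fun _ _ => by positivity,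
          ← ENNReal.ofReal_sum_of_nonneg fun _ _ => by positivity,
          ← ENNReal.ofReal_add (by positivity) (by positivity)]
        congr 1
        simp only [Finset.sum_const, Finset.card_univ, Fintype.card_fin, Fintype.card_prod,
          nsmul_eq_mul, Nat.cast_mul]
        field_simp
        norm_num

end Prior

/-! ### The noise of a phase that begins in a fixed state -/

section Noise

variable {d m k : ℕ} {Ω : Type*} [MeasurableSpace Ω] {P : Measure Ω}
  {a : Fin k → EuclideanSpace ℝ (Fin d)} {C : Matrix (Fin d) (Fin d) ℝ} {δ : ℝ}
  {D : Finset (Fin k) → Fin k → ℝ} {ξ : Fin m → ℕ → Ω → ℝ} {l : ℕ}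

theorem inner_noiseEst (ξ : Fin m → ℕ → ℝ) (st : PhaseState m k) (i : Fin m)
    (v : EuclideanSpace ℝ (Fin d)) :
    ⟪v, noiseEst a C δ D ξ l st i⟫
      = ∑ s, lsCoeff a (phaseList m a C δ D l (st.active i)) v s * ξ i (st.start i + s) :=
  inner_lsEstimate _ _ _ _

theorem measure_not_goodPhase_le (hk : 1 ≤ k) (hm : 1 ≤ m) (hl : 1 ≤ l) (hδ : 0 < δ)
    (hδ1 : δ < 1) (hD : IsDesignRule a D) (hlaw : ∀ i t, HasLaw (ξ i t) (gaussianReal 0 1) P)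
    (hind : iIndepFun (fun q : Fin m × ℕ => ξ q.1 q.2) P) (st : PhaseState m k) :
    P {ω | ¬ GoodPhase a C δ D (fun i t => ξ i t ω) l st}
      ≤ ENNReal.ofReal (δ / (2 * l * (l + 1))) := by
  have hm0 : (0 : ℝ) < m := by exact_mod_cast hm
  have hk0 : (0 : ℝ) < k := by exact_mod_cast hk
  have hl0 : (0 : ℝ) < l := by exact_mod_cast hl
  have he := eps_pos l
  have hgauss : ∀ i t, HasGaussianLaw (ξ i t) P := fun i t => (hlaw i t).hasGaussianLaw
  have hmean : ∀ i t, ∫ ω, ξ i t ω ∂P = 0 := fun i t => by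
    rw [(hlaw i t).integral_eq, integral_id_gaussianReal]
  have hvar : ∀ i t, Var[ξ i t; P] ≤ 1 := fun i t => by
    rw [(hlaw i t).variance_eq, variance_id_gaussianReal, NNReal.coe_one]
  have hr0 : 0 ≤ rate m a C δ l := rate_nonneg hk hm hl hδ hδ1
  by_cases hc : IsCollab m a C δ l
  · have hL := log_collab_nonneg hk hl hδ hδ1
    have hrate : rate m a C δ l = 8 / (m * eps l ^ 2) * Real.log (2 * k * l * (l + 1) / δ) :=
      if_pos hc
    have hone : ∀ x, P {ω | (∀ i, x ∈ st.active i) ∧ eps l / 2 <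
        |1 / (m : ℝ) * ∑ j, ⟪a x, noiseEst a C δ D (fun i t => ξ i t ω) l st j⟫|}
        ≤ ENNReal.ofReal (δ / (2 * k * l * (l + 1))) := by
      intro x
      by_cases hx : ∀ i, x ∈ st.active i
      · let c : (Σ i, Fin (phaseList m a C δ D l (st.active i)).length) → ℝ := fun q =>
          1 / (m : ℝ) * lsCoeff a (phaseList m a C δ D l (st.active q.1)) (a x) q.2
        have hset : {ω | (∀ i, x ∈ st.active i) ∧ eps l / 2 <
            |1 / (m : ℝ) * ∑ j, ⟪a x, noiseEst a C δ D (fun i t => ξ i t ω) l st j⟫|}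
            ⊆ {ω | eps l / 2 < |∑ q, c q * ξ q.1 (st.start q.1 + q.2) ω|} := by
          intro ω hω
          have h1 := hω.2
          simp only [inner_noiseEst, Finset.mul_sum] at h1
          rw [Finset.sum_sigma', Finset.univ_sigma_univ] at h1
          simpa only [c, mul_assoc, Set.mem_ofPred_eq] using h1
        refine (measure_mono hset).trans ((measure_abs_sum_gt_le (fun q => hgauss _ _)
          (fun q => hmean _ _) (fun q => hvar _ _) ?_ c hL (by positivity) ?_).trans
          (le_of_eq ?_))
        · refine hind.precomp (g := fun q : Σ i, Fin (phaseList m a C δ D l (st.active i)).length =>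
            (q.1, st.start q.1 + q.2)) ?_
          rintro ⟨i, s⟩ ⟨i', s'⟩ h
          obtain ⟨rfl, h2⟩ := Prod.mk.inj h
          simp only [Nat.add_left_cancel_iff] at h2
          rw [Fin.ext h2]
        · have hsum : rate m a C δ l * ∑ q, c q ^ 2 ≤ (1 / m : ℝ) := by
            have h1 : ∑ q, c q ^ 2 = (1 / (m : ℝ)) ^ 2 * ∑ i : Fin m,
                ∑ s, lsCoeff a (phaseList m a C δ D l (st.active i)) (a x) s ^ 2 := by
              rw [Fintype.sum_sigma, Finset.mul_sum]
              refine Finset.sum_congr rfl fun i _ => ?_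
              rw [Finset.mul_sum]
              exact Finset.sum_congr rfl fun s _ => mul_pow _ _ _
            rw [h1, mul_left_comm, Finset.mul_sum]
            calc (1 / (m : ℝ)) ^ 2 * ∑ i : Fin m, rate m a C δ l *
                  ∑ s, lsCoeff a (phaseList m a C δ D l (st.active i)) (a x) s ^ 2
                ≤ (1 / (m : ℝ)) ^ 2 * ∑ _i : Fin m, 1 := by
                  refine mul_le_mul_of_nonneg_left (Finset.sum_le_sum fun i _ => ?_)
                    (by positivity)
                  exact rate_mul_sum_lsCoeff_sq_le hD (hx i) hr0
              _ = (1 / m : ℝ) := by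
                  simp only [Finset.sum_const, Finset.card_univ, Fintype.card_fin, nsmul_eq_mul]
                  field_simp
          rw [hrate, div_mul_eq_mul_div, div_mul_eq_mul_div, div_le_div_iff₀ (by positivity) hm0]
            at hsum
          nlinarith
        · rw [← Real.log_inv, Real.exp_log (by positivity), inv_div]
      · simp [hx]
    calc P {ω | ¬ GoodPhase a C δ D (fun i t => ξ i t ω) l st}
        ≤ P (⋃ x, {ω | (∀ i, x ∈ st.active i) ∧ eps l / 2 <
          |1 / (m : ℝ) * ∑ j, ⟪a x, noiseEst a C δ D (fun i t => ξ i t ω) l st j⟫|}) := by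
          refine measure_mono fun ω hω => ?_
          by_contra h
          simp only [Set.mem_iUnion, Set.mem_ofPred_eq, not_exists, not_and, not_lt] at h
          exact hω ⟨fun _ => h, fun h' => absurd hc h'⟩
      _ ≤ ∑ _x : Fin k, ENNReal.ofReal (δ / (2 * k * l * (l + 1))) :=
          (measure_iUnion_fintype_le _ _).trans (Finset.sum_le_sum fun x _ => hone x)
      _ = ENNReal.ofReal (δ / (2 * l * (l + 1))) := by
          rw [← ENNReal.ofReal_sum_of_nonneg fun _ _ => by positivity]
          congr 1
          simp only [Finset.sum_const, Finset.card_univ, Fintype.card_fin, nsmul_eq_mul]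
          field_simp
  · have hL := log_personal_nonneg hk hm hl hδ hδ1
    have hrate : rate m a C δ l = 2 / eps l ^ 2 * Real.log (2 * k * m * l * (l + 1) / δ) :=
      if_neg hc
    have hone : ∀ i x, P {ω | x ∈ st.active i ∧ eps l <
        |⟪a x, noiseEst a C δ D (fun i t => ξ i t ω) l st i⟫|}
        ≤ ENNReal.ofReal (δ / (2 * k * m * l * (l + 1))) := by
      intro i x
      by_cases hx : x ∈ st.active i
      · simp only [inner_noiseEst, hx, true_and]
        refine (measure_abs_sum_gt_le (fun s => hgauss _ _) (fun s => hmean _ _)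
          (fun s => hvar _ _) ?_ _ hL he.le ?_).trans (le_of_eq ?_)
        · refine hind.precomp (g := fun s : Fin (phaseList m a C δ D l (st.active i)).length =>
            (i, st.start i + (s : ℕ))) ?_
          intro s s' h
          have h2 := (Prod.mk.inj h).2
          simp only [Nat.add_left_cancel_iff] at h2
          exact Fin.ext h2
        · have hsum := rate_mul_sum_lsCoeff_sq_le (S := st.active i) hD hx hr0
          rw [hrate, div_mul_eq_mul_div, div_mul_eq_mul_div, div_le_one (by positivity)] at hsum
          linarith
        · rw [← Real.log_inv, Real.exp_log (by positivity), inv_div]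
      · simp [hx]
    calc P {ω | ¬ GoodPhase a C δ D (fun i t => ξ i t ω) l st}
        ≤ P (⋃ q : Fin m × Fin k, {ω | q.2 ∈ st.active q.1 ∧ eps l <
          |⟪a q.2, noiseEst a C δ D (fun i t => ξ i t ω) l st q.1⟫|}) := by
          refine measure_mono fun ω hω => ?_
          by_contra h
          simp only [Set.mem_iUnion, Set.mem_ofPred_eq, not_exists, not_and, not_lt] at h
          exact hω ⟨fun h' => absurd h' hc, fun _ i x => h (i, x)⟩
      _ ≤ ∑ _q : Fin m × Fin k, ENNReal.ofReal (δ / (2 * k * m * l * (l + 1))) :=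
          (measure_iUnion_fintype_le _ _).trans (Finset.sum_le_sum fun q _ => hone q.1 q.2)
      _ = ENNReal.ofReal (δ / (2 * l * (l + 1))) := by
          rw [← ENNReal.ofReal_sum_of_nonneg fun _ _ => by positivity]
          congr 1
          simp only [Finset.sum_const, Finset.card_univ, Fintype.card_fin, Fintype.card_prod,
            nsmul_eq_mul, Nat.cast_mul]
          field_simp

end Noise

/-! ### The state of the algorithm and the noise of the next phase -/

section State

variable {d m k : ℕ} {a : Fin k → EuclideanSpace ℝ (Fin d)} {C : Matrix (Fin d) (Fin d) ℝ}
  {δ : ℝ} {D : Finset (Fin k) → Fin k → ℝ}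

instance : Countable (PhaseState m k) := by
  have : Function.Injective fun st : PhaseState m k => (st.active, st.start) := by
    rintro ⟨A, s⟩ ⟨A', s'⟩ h
    simpa using h
  exact this.countable

theorem PhaseState.eq_iff {st st' : PhaseState m k} :
    st = st' ↔ (∀ i x, x ∈ st.active i ↔ x ∈ st'.active i) ∧ ∀ i, st.start i = st'.start i := by
  obtain ⟨A, s⟩ := st
  obtain ⟨A', s'⟩ := st'
  simp only [PhaseState.mk.injEq, funext_iff, Finset.ext_iff]

/-- The outcome of a phase depends only on the noise of the rounds of that phase. -/
theorem runPhase_congr (θ : Fin m → EuclideanSpace ℝ (Fin d)) {ξ ξ' : Fin m → ℕ → ℝ} {l : ℕ}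
    {st : PhaseState m k}
    (h : ∀ i t, t < st.start i + (phaseList m a C δ D l (st.active i)).length → ξ i t = ξ' i t) :
    runPhase a C δ D θ ξ l st = runPhase a C δ D θ ξ' l st := by
  have hown : ownEst a C δ D θ ξ l st = ownEst a C δ D θ ξ' l st := by
    funext i
    unfold ownEst
    congr 1
    funext s
    rw [h i _ (Nat.add_lt_add_left s.2 _)]
  refine PhaseState.eq_iff.2 ⟨fun i x => ?_, fun i => rfl⟩
  simp only [mem_runPhase_active, phaseEst, hown]

/-- The state at the beginning of a phase depends only on the noise of the rounds before. -/
theorem stateAt_congr (θ : Fin m → EuclideanSpace ℝ (Fin d)) {ξ ξ' : Fin m → ℕ → ℝ} {j : ℕ}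
    (h : ∀ i t, t < (stateAt a C δ D θ ξ j).start i → ξ i t = ξ' i t) :
    stateAt a C δ D θ ξ j = stateAt a C δ D θ ξ' j := by
  induction j with
  | zero => rfl
  | succ j ih =>
    have h1 := ih fun i t ht => h i t (ht.trans_le (Nat.le_add_right _ _))
    have h2 : stateAt a C δ D θ ξ (j + 1)
        = runPhase a C δ D θ ξ' (j + 1) (stateAt a C δ D θ ξ j) :=
      runPhase_congr θ fun i t ht => h i t ht
    rw [h2, h1]
    rfl

/-- `GoodPhase` depends only on the noise of the rounds of the phase. -/
theorem goodPhase_congr {ξ ξ' : Fin m → ℕ → ℝ} {l : ℕ} {st : PhaseState m k}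
    (h : ∀ i, ∀ t ∈ Finset.Ico (st.start i)
      (st.start i + (phaseList m a C δ D l (st.active i)).length), ξ i t = ξ' i t) :
    GoodPhase a C δ D ξ l st ↔ GoodPhase a C δ D ξ' l st := by
  have hn : noiseEst a C δ D ξ l st = noiseEst a C δ D ξ' l st := by
    funext i
    unfold noiseEst
    congr 1
    funext s
    exact h i _ (Finset.mem_Ico.2 ⟨Nat.le_add_right _ _, Nat.add_lt_add_left s.2 _⟩)
  simp only [GoodPhase, hn]

theorem measurable_inner_ownEst (l : ℕ) (st : PhaseState m k) (i : Fin m)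
    (v : EuclideanSpace ℝ (Fin d)) :
    Measurable fun p : (Fin m → EuclideanSpace ℝ (Fin d)) × (Fin m → ℕ → ℝ) =>
      ⟪v, ownEst a C δ D p.1 p.2 l st i⟫ := by
  simp only [ownEst, inner_lsEstimate]
  fun_prop

theorem measurable_inner_phaseEst (l : ℕ) (st : PhaseState m k) (i : Fin m)
    (v : EuclideanSpace ℝ (Fin d)) :
    Measurable fun p : (Fin m → EuclideanSpace ℝ (Fin d)) × (Fin m → ℕ → ℝ) =>
      ⟪phaseEst a C δ D p.1 p.2 l st i, v⟫ := by
  simp only [real_inner_comm v]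
  by_cases hc : IsCollab m a C δ l
  · simp only [phaseEst, if_pos hc, inner_smul_right, inner_sum]
    exact (Finset.measurable_sum _ fun j _ => measurable_inner_ownEst l st j v).const_mul _
  · simp only [phaseEst, if_neg hc]
    exact measurable_inner_ownEst l st i v

theorem measurableSet_runPhase_eq (l : ℕ) (st st' : PhaseState m k) :
    MeasurableSet {p : (Fin m → EuclideanSpace ℝ (Fin d)) × (Fin m → ℕ → ℝ) |
      runPhase a C δ D p.1 p.2 l st = st'} := by
  simp only [PhaseState.eq_iff, mem_runPhase_active, runPhase_start]
  refine measurableSet_setOfPred.2 (Measurable.and ?_ measurable_const)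
  refine Measurable.forall fun i => Measurable.forall fun x => Measurable.iff
    (Measurable.and measurable_const ?_) measurable_const
  refine Measurable.forall fun x' => Measurable.imp measurable_const (measurableSet_setOfPred.1 ?_)
  exact measurableSet_le (measurable_inner_phaseEst l st i _) measurable_const

theorem measurableSet_stateAt_eq (j : ℕ) (st : PhaseState m k) :
    MeasurableSet {p : (Fin m → EuclideanSpace ℝ (Fin d)) × (Fin m → ℕ → ℝ) |
      stateAt a C δ D p.1 p.2 j = st} := by
  induction j generalizing st with
  | zero =>
    simp only [stateAt]
    exact measurableSet_setOfPred.2 measurable_const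
  | succ j ih =>
    have h : {p : (Fin m → EuclideanSpace ℝ (Fin d)) × (Fin m → ℕ → ℝ) |
        stateAt a C δ D p.1 p.2 (j + 1) = st}
        = ⋃ st', {p | stateAt a C δ D p.1 p.2 j = st'} ∩
          {p | runPhase a C δ D p.1 p.2 (j + 1) st' = st} := by
      ext p
      simp [stateAt]
    rw [h]
    exact MeasurableSet.iUnion fun st' => (ih st').inter (measurableSet_runPhase_eq _ _ _)

theorem measurableSet_goodPhase (l : ℕ) (st : PhaseState m k) :
    MeasurableSet {ξ : Fin m → ℕ → ℝ | GoodPhase a C δ D ξ l st} := by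
  simp only [GoodPhase, inner_noiseEst]
  measurability

end State

section Independence

variable {Ω : Type*} [MeasurableSpace Ω] {P : Measure Ω} [IsProbabilityMeasure P]

/-- If `X` is independent of `(U, V)` and `U` is independent of `V`, then `(X, U)` is independent
of `V`. -/
theorem indepFun_prodMk_of_indepFun {α β γ : Type*} [MeasurableSpace α] [MeasurableSpace β]
    [MeasurableSpace γ] {X : Ω → α} {U : Ω → β} {V : Ω → γ} (hX : Measurable X)
    (hU : Measurable U) (hV : Measurable V) (h : IndepFun X (fun ω => (U ω, V ω)) P)
    (hUV : IndepFun U V P) : IndepFun (fun ω => (X ω, U ω)) V P := by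
  have hXU : IndepFun X U P := h.comp measurable_id measurable_fst
  have hpX := Measure.isProbabilityMeasure_map (μ := P) hX.aemeasurable
  have hpU := Measure.isProbabilityMeasure_map (μ := P) hU.aemeasurable
  have hpV := Measure.isProbabilityMeasure_map (μ := P) hV.aemeasurable
  rw [indepFun_iff_map_prod_eq_prod_map_map (by fun_prop) (by fun_prop)] at h hUV hXU ⊢
  rw [hUV] at h
  rw [hXU]
  have hassoc := (measurePreserving_prodAssoc (P.map X) (P.map U) (P.map V)).symm
  rw [← hassoc.map_eq, ← h, Measure.map_map (by fun_prop) (by fun_prop)]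
  rfl

end Independence

/-! ### The noise of all phases -/

section Union

variable {d m k : ℕ} {Ω : Type*} [MeasurableSpace Ω] {P : Measure Ω} [IsProbabilityMeasure P]
  {a : Fin k → EuclideanSpace ℝ (Fin d)} {C : Matrix (Fin d) (Fin d) ℝ} {δ : ℝ}
  {D : Finset (Fin k) → Fin k → ℝ} {θ : Fin m → Ω → EuclideanSpace ℝ (Fin d)}
  {ξ : Fin m → ℕ → Ω → ℝ}

open Classical in
/-- The noise with given values in the rounds in `F` and zero elsewhere. -/
noncomputable def extendNoise (F : Finset (Fin m × ℕ)) (u : F → ℝ) (i : Fin m) (t : ℕ) : ℝ :=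
  if h : (i, t) ∈ F then u ⟨(i, t), h⟩ else 0

theorem measurable_extendNoise (F : Finset (Fin m × ℕ)) : Measurable (extendNoise (m := m) F) := by
  refine measurable_pi_lambda _ fun i => measurable_pi_lambda _ fun t => ?_
  unfold extendNoise
  split_ifs with h
  · exact measurable_pi_apply _
  · exact measurable_const

/-- The rounds of each user `i` in `[s i, e i)`. -/
def rounds (s e : Fin m → ℕ) : Finset (Fin m × ℕ) :=
  Finset.univ.biUnion fun i => (Finset.Ico (s i) (e i)).map (Function.Embedding.sectR i ℕ)

theorem mem_rounds {s e : Fin m → ℕ} {i : Fin m} {t : ℕ} :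
    (i, t) ∈ rounds s e ↔ t ∈ Finset.Ico (s i) (e i) := by
  simp [rounds]

/-- The noise of a phase is independent of the state in which the phase begins. -/
theorem measure_stateAt_eq_and_not_goodPhase (hθ : ∀ i, Measurable (θ i))
    (hξ : ∀ i t, Measurable (ξ i t))
    (hind : iIndepFun (fun q : Fin m × ℕ => ξ q.1 q.2) P)
    (hindep : IndepFun (fun ω (i : Fin m) => θ i ω) (fun ω (q : Fin m × ℕ) => ξ q.1 q.2 ω) P)
    (j l : ℕ) (st : PhaseState m k) :
    P {ω | stateAt a C δ D (fun i => θ i ω) (fun i t => ξ i t ω) j = st ∧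
        ¬ GoodPhase a C δ D (fun i t => ξ i t ω) l st}
      = P {ω | stateAt a C δ D (fun i => θ i ω) (fun i t => ξ i t ω) j = st}
        * P {ω | ¬ GoodPhase a C δ D (fun i t => ξ i t ω) l st} := by
  set F := rounds (fun _ => 0) st.start with hF
  set F' := rounds st.start
    (fun i => st.start i + (phaseList m a C δ D l (st.active i)).length) with hF'
  have hdisj : Disjoint F F' := by
    rw [Finset.disjoint_left]
    rintro ⟨i, t⟩ h1 h2
    rw [mem_rounds, Finset.mem_Ico] at h1 h2
    omega
  let U : Ω → F → ℝ := fun ω q => ξ q.1.1 q.1.2 ω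
  let V : Ω → F' → ℝ := fun ω q => ξ q.1.1 q.1.2 ω
  have hU : Measurable U := measurable_pi_lambda _ fun q => hξ _ _
  have hV : Measurable V := measurable_pi_lambda _ fun q => hξ _ _
  have hUV : IndepFun U V P := hind.indepFun_finset F F' hdisj fun q => hξ _ _
  have hXUV : IndepFun (fun ω (i : Fin m) => θ i ω) (fun ω => (U ω, V ω)) P :=
    hindep.comp (φ := id)
      (ψ := fun z : Fin m × ℕ → ℝ => ((fun q : F => z q.1), (fun q : F' => z q.1)))
      measurable_id (by fun_prop)
  have hmain := indepFun_prodMk_of_indepFun (measurable_pi_lambda _ hθ) hU hV hXUV hUV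
  set A : Set ((Fin m → EuclideanSpace ℝ (Fin d)) × (F → ℝ)) :=
    {p | stateAt a C δ D p.1 (extendNoise F p.2) j = st} with hA
  set B : Set (F' → ℝ) := {p | ¬ GoodPhase a C δ D (extendNoise F' p) l st} with hB
  have hAm : MeasurableSet A :=
    (measurable_fst.prodMk ((measurable_extendNoise F).comp measurable_snd))
      (measurableSet_stateAt_eq j st)
  have hBm : MeasurableSet B := (measurable_extendNoise F') (measurableSet_goodPhase l st).compl
  have hAeq : {ω | stateAt a C δ D (fun i => θ i ω) (fun i t => ξ i t ω) j = st}
      = (fun ω => ((fun i => θ i ω), U ω)) ⁻¹' A := by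
    ext ω
    have hagree : ∀ i t, t < st.start i → ξ i t ω = extendNoise F (U ω) i t := by
      intro i t ht
      have hmem : (i, t) ∈ F := mem_rounds.2 (Finset.mem_Ico.2 ⟨Nat.zero_le _, ht⟩)
      rw [extendNoise, dif_pos hmem]
    constructor
    · intro h
      have h : stateAt a C δ D (fun i => θ i ω) (fun i t => ξ i t ω) j = st := h
      have h1 := stateAt_congr (a := a) (C := C) (δ := δ) (D := D) (j := j) (fun i => θ i ω)
        (ξ := fun i t => ξ i t ω) (ξ' := extendNoise F (U ω))
        (fun i t ht => hagree i t (by rwa [h] at ht))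
      exact h1.symm.trans h
    · intro h
      have h : stateAt a C δ D (fun i => θ i ω) (extendNoise F (U ω)) j = st := h
      have h1 := stateAt_congr (a := a) (C := C) (δ := δ) (D := D) (j := j) (fun i => θ i ω)
        (ξ := extendNoise F (U ω)) (ξ' := fun i t => ξ i t ω)
        (fun i t ht => (hagree i t (by rwa [h] at ht)).symm)
      exact h1.symm.trans h
  have hBeq : {ω | ¬ GoodPhase a C δ D (fun i t => ξ i t ω) l st} = V ⁻¹' B := by
    ext ω
    refine not_congr (goodPhase_congr fun i t ht => ?_)
    have hmem : (i, t) ∈ F' := mem_rounds.2 ht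
    rw [extendNoise, dif_pos hmem]
  have hinter := hmain.measure_inter_preimage_eq_mul A B hAm hBm
  rw [← hAeq, ← hBeq] at hinter
  exact hinter

theorem sum_one_div_mul_succ_le_one (n : ℕ) :
    ∑ j ∈ Finset.range n, 1 / (((j + 1 : ℕ) : ℝ) * ((j + 1 : ℕ) + 1)) ≤ 1 := by
  have h : ∑ j ∈ Finset.range n, 1 / (((j + 1 : ℕ) : ℝ) * ((j + 1 : ℕ) + 1))
      = 1 - 1 / ((n : ℝ) + 1) := by
    induction n with
    | zero => simp
    | succ n ih =>
      rw [Finset.sum_range_succ, ih]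
      push_cast
      field_simp
      ring
  rw [h]
  have : (0 : ℝ) ≤ 1 / ((n : ℝ) + 1) := by positivity
  linarith

/-- Summing over the state in which a phase begins, each phase fails with the probability it would
have from a fixed state; these probabilities add up to at most `δ / 2`. -/
theorem measure_exists_not_goodPhase_le (hk : 1 ≤ k) (hm : 1 ≤ m) (hδ : 0 < δ) (hδ1 : δ < 1)
    (hD : IsDesignRule a D) (hθ : ∀ i, Measurable (θ i)) (hξ : ∀ i t, Measurable (ξ i t))
    (hlaw : ∀ i t, HasLaw (ξ i t) (gaussianReal 0 1) P)
    (hind : iIndepFun (fun q : Fin m × ℕ => ξ q.1 q.2) P)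
    (hindep : IndepFun (fun ω (i : Fin m) => θ i ω) (fun ω (q : Fin m × ℕ) => ξ q.1 q.2 ω) P)
    (n : ℕ) :
    P {ω | ∃ j < n, ¬ GoodPhase a C δ D (fun i t => ξ i t ω) (j + 1)
        (stateAt a C δ D (fun i => θ i ω) (fun i t => ξ i t ω) j)}
      ≤ ENNReal.ofReal (δ / 2) := by
  have hmeas : ∀ j st, MeasurableSet
      {ω | stateAt a C δ D (fun i => θ i ω) (fun i t => ξ i t ω) j = st} := fun j st =>
    ((measurable_pi_lambda _ hθ).prodMk
      (measurable_pi_lambda _ fun i => measurable_pi_lambda _ (hξ i)))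
      (measurableSet_stateAt_eq j st)
  have hphase : ∀ j, P {ω | ¬ GoodPhase a C δ D (fun i t => ξ i t ω) (j + 1)
        (stateAt a C δ D (fun i => θ i ω) (fun i t => ξ i t ω) j)}
      ≤ ENNReal.ofReal (δ / (2 * (j + 1 : ℕ) * ((j + 1 : ℕ) + 1))) := by
    intro j
    calc P {ω | ¬ GoodPhase a C δ D (fun i t => ξ i t ω) (j + 1)
          (stateAt a C δ D (fun i => θ i ω) (fun i t => ξ i t ω) j)}
        ≤ P (⋃ st, {ω | stateAt a C δ D (fun i => θ i ω) (fun i t => ξ i t ω) j = st ∧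
          ¬ GoodPhase a C δ D (fun i t => ξ i t ω) (j + 1) st}) := by
          refine measure_mono fun ω hω => Set.mem_iUnion.2 ⟨_, rfl, hω⟩
      _ ≤ ∑' st, P {ω | stateAt a C δ D (fun i => θ i ω) (fun i t => ξ i t ω) j = st ∧
          ¬ GoodPhase a C δ D (fun i t => ξ i t ω) (j + 1) st} := measure_iUnion_le _
      _ ≤ ∑' st, P {ω | stateAt a C δ D (fun i => θ i ω) (fun i t => ξ i t ω) j = st}
          * ENNReal.ofReal (δ / (2 * (j + 1 : ℕ) * ((j + 1 : ℕ) + 1))) := by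
          refine ENNReal.tsum_le_tsum fun st => ?_
          rw [measure_stateAt_eq_and_not_goodPhase hθ hξ hind hindep]
          gcongr
          exact measure_not_goodPhase_le hk hm (Nat.succ_le_succ (Nat.zero_le j)) hδ hδ1 hD hlaw
            hind st
      _ ≤ 1 * ENNReal.ofReal (δ / (2 * (j + 1 : ℕ) * ((j + 1 : ℕ) + 1))) := by
          rw [ENNReal.tsum_mul_right]
          gcongr
          rw [← measure_univ (μ := P)]
          refine tsum_measure_le_measure_univ (fun st => (hmeas j st).nullMeasurableSet) ?_
          intro st st' hne
          refine Disjoint.aedisjoint (Set.disjoint_left.2 fun ω h h' => hne ?_)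
          exact Eq.trans (Eq.symm h) h'
      _ = _ := one_mul _
  have hsub : {ω | ∃ j < n, ¬ GoodPhase a C δ D (fun i t => ξ i t ω) (j + 1)
        (stateAt a C δ D (fun i => θ i ω) (fun i t => ξ i t ω) j)}
      ⊆ ⋃ j ∈ Finset.range n, {ω | ¬ GoodPhase a C δ D (fun i t => ξ i t ω) (j + 1)
        (stateAt a C δ D (fun i => θ i ω) (fun i t => ξ i t ω) j)} := by
    rintro ω ⟨j, hj, h⟩
    simp only [Set.mem_iUnion]
    exact ⟨j, Finset.mem_range.2 hj, h⟩
  refine (measure_mono hsub).trans ((measure_biUnion_finset_le _ _).trans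
    ((Finset.sum_le_sum fun j _ => hphase j).trans ?_))
  rw [← ENNReal.ofReal_sum_of_nonneg fun _ _ => by positivity]
  refine ENNReal.ofReal_le_ofReal ?_
  have h := mul_le_mul_of_nonneg_left (sum_one_div_mul_succ_le_one n) (half_pos hδ).le
  rw [mul_one, Finset.mul_sum] at h
  refine le_trans (le_of_eq (Finset.sum_congr rfl fun j _ => ?_)) h
  field_simp

end Union

/-! ### The regret bounds -/

section RegretBounds

variable {d m k n : ℕ} {σ δ : ℝ}

theorem quad_smul_one (σ : ℝ) (v : EuclideanSpace ℝ (Fin d)) :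
    quad (σ ^ 2 • (1 : Matrix (Fin d) (Fin d) ℝ)) v = σ ^ 2 * ‖v‖ ^ 2 := by
  rw [quad, smul_mulVec, one_mulVec, dotProduct_smul, smul_eq_mul, ← real_inner_eq_dotProduct,
    real_inner_self_eq_norm_sq]

theorem iSup_quad_smul_one_le {a : Fin k → EuclideanSpace ℝ (Fin d)} (ha : ∀ x, ‖a x‖ ≤ 1) :
    ⨆ x, quad (σ ^ 2 • (1 : Matrix (Fin d) (Fin d) ℝ)) (a x) ≤ σ ^ 2 := by
  refine Real.iSup_le (fun x => ?_) (sq_nonneg σ)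
  rw [quad_smul_one]
  exact mul_le_of_le_one_right (sq_nonneg σ) (pow_le_one₀ (norm_nonneg _) (ha x))

theorem iSup_quad_smul_one_nonneg (a : Fin k → EuclideanSpace ℝ (Fin d)) :
    0 ≤ ⨆ x, quad (σ ^ 2 • (1 : Matrix (Fin d) (Fin d) ℝ)) (a x) :=
  Real.iSup_nonneg fun x => by rw [quad_smul_one]; positivity

/-- With probability at least `1 - δ` the prior event and the noise events of all phases occur
together, so that the bound on the good event holds. -/
theorem regretAtMost_of_rate_le (hadm : Admissible d m k n σ δ) {η ρ B : ℝ} (hη : 0 < η)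
    (hρ : 0 ≤ ρ)
    (hrate : ∀ a : Fin k → EuclideanSpace ℝ (Fin d), (∀ x, ‖a x‖ ≤ 1) → ∀ j < n,
      η < eps (j + 1) →
        rate m a (σ ^ 2 • (1 : Matrix (Fin d) (Fin d) ℝ)) δ (j + 1) ≤ ρ / eps (j + 1) ^ 2)
    (hB : ∀ a : Fin k → EuclideanSpace ℝ (Fin d), (∀ x, ‖a x‖ ≤ 1) →
      m * ((8 + 4 * userDev m a (σ ^ 2 • (1 : Matrix (Fin d) (Fin d) ℝ)) δ)
        * (η * n + d ^ 2 + 2 * ρ * d / η)) ≤ B) :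
    RegretAtMost.{u} d m k n σ δ B := by
  intro a _ ha D hD μ hμ Ω _ P _ θ ξ hmodel
  obtain ⟨hd, hm, hk, -, hσ, -, hδ, hδ1⟩ := hadm
  set C := σ ^ 2 • (1 : Matrix (Fin d) (Fin d) ℝ) with hCdef
  have hC : C.PosSemidef := Matrix.PosSemidef.one.smul (sq_nonneg σ)
  -- pass to measurable versions of the parameters and the noise
  have hθm : ∀ i, AEMeasurable (θ i) P := fun i => (hmodel.param_law i).aemeasurable
  have hξm : ∀ i t, AEMeasurable (ξ i t) P := fun i t => (hmodel.noise_law i t).aemeasurable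
  set θ' : Fin m → Ω → EuclideanSpace ℝ (Fin d) := fun i => (hθm i).mk (θ i) with hθ'
  set ξ' : Fin m → ℕ → Ω → ℝ := fun i t => (hξm i t).mk (ξ i t) with hξ'
  have hθe : ∀ i, θ i =ᵐ[P] θ' i := fun i => (hθm i).ae_eq_mk
  have hξe : ∀ i t, ξ i t =ᵐ[P] ξ' i t := fun i t => (hξm i t).ae_eq_mk
  have hθe' : (fun ω i => θ i ω) =ᵐ[P] fun ω i => θ' i ω := by
    filter_upwards [ae_all_iff.2 hθe] with ω hω using funext hω
  have hξe' : (fun ω i t => ξ i t ω) =ᵐ[P] fun ω i t => ξ' i t ω := by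
    filter_upwards [ae_all_iff.2 fun i => ae_all_iff.2 (hξe i)] with ω hω
      using funext fun i => funext (hω i)
  have hξe'' : (fun ω (q : Fin m × ℕ) => ξ q.1 q.2 ω) =ᵐ[P] fun ω q => ξ' q.1 q.2 ω := by
    filter_upwards [hξe'] with ω hω using funext fun q => congrFun (congrFun hω q.1) q.2
  have hprior := measure_not_goodPrior_le (P := P) (a := a) (θ := θ') hC hk hm hδ hδ1
    (fun i => (hmodel.param_law i).congr (hθe i).symm) ((iIndepFun_congr hθe).1 hmodel.param_indep)
  have hnoise := measure_exists_not_goodPhase_le (P := P) (a := a) (C := C) (θ := θ') (ξ := ξ')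
    hk hm hδ hδ1 hD (fun i => (hθm i).measurable_mk) (fun i t => (hξm i t).measurable_mk)
    (fun i t => (hmodel.noise_law i t).congr (hξe i t).symm)
    ((iIndepFun_congr fun q : Fin m × ℕ => hξe q.1 q.2).1 hmodel.noise_indep)
    (hmodel.indep.congr hθe' hξe'') n
  set G : Set Ω := {ω | regret a C δ D n (fun i => θ i ω) (fun i t => ξ i t ω) ≤ B} with hG
  have hcover : P Set.univ ≤ P (G ∪ ({ω | ¬ GoodPrior a C δ μ fun i => θ' i ω} ∪
      {ω | ∃ j < n, ¬ GoodPhase a C δ D (fun i t => ξ' i t ω) (j + 1)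
        (stateAt a C δ D (fun i => θ' i ω) (fun i t => ξ' i t ω) j)})) := by
    refine measure_mono_ae ?_
    filter_upwards [hθe', hξe'] with ω h1 h2 _
    by_cases h3 : GoodPrior a C δ μ fun i => θ' i ω
    · by_cases h4 : ∃ j < n, ¬ GoodPhase a C δ D (fun i t => ξ' i t ω) (j + 1)
          (stateAt a C δ D (fun i => θ' i ω) (fun i t => ξ' i t ω) j)
      · exact Or.inr (Or.inr h4)
      · refine Or.inl ?_
        push Not at h4
        show regret a C δ D n (fun i => θ i ω) (fun i t => ξ i t ω) ≤ B
        rw [h1, h2]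
        exact (regret_le hk hm ha hD hμ h3 h4 hη hρ
          (fun j _ => rate_nonneg hk hm (Nat.succ_le_succ (Nat.zero_le j)) hδ hδ1)
          (hrate a ha)).trans (hB a ha)
    · exact Or.inr (Or.inl h3)
  have hle : (1 : ENNReal) ≤ P G + ENNReal.ofReal δ := by
    rw [← measure_univ (μ := P)]
    refine hcover.trans ((measure_union_le _ _).trans (add_le_add le_rfl
      ((measure_union_le _ _).trans ((add_le_add hprior hnoise).trans (le_of_eq ?_)))))
    rw [← ENNReal.ofReal_add (by positivity) (by positivity), add_halves]
  have h5 := ENNReal.toReal_mono (by finiteness) hle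
  rw [ENNReal.toReal_add (by finiteness) (by finiteness), ENNReal.toReal_ofReal hδ.le] at h5
  simp only [ENNReal.toReal_one] at h5
  change 1 - δ ≤ (P G).toReal
  linarith

theorem Admissible.one_le_n (hadm : Admissible d m k n σ δ) : 1 ≤ n :=
  (Nat.one_le_iff_ne_zero.2 (by
    have h1 := hadm.d_pos
    have h2 := hadm.k_pos
    rcases min_choice k (d ^ 2) with h | h <;> rw [h] <;> positivity)).trans hadm.le_n

theorem Admissible.one_le_div (hadm : Admissible d m k n σ δ) : 1 ≤ (k * m * n / δ : ℝ) := by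
  refine one_le_div_of_delta ?_ hadm.delta_pos hadm.delta_lt
  have h1 := hadm.m_pos
  have h2 := hadm.k_pos
  have h3 := hadm.one_le_n
  exact_mod_cast (Nat.one_le_iff_ne_zero.2 (by positivity) : 1 ≤ k * m * n)

theorem Admissible.one_le_logFactor (hadm : Admissible d m k n σ δ) : 1 ≤ logFactor m k n δ := by
  have := Real.log_nonneg hadm.one_le_div
  unfold logFactor
  linarith

theorem Admissible.log_le_two_mul_logFactor (hadm : Admissible d m k n σ δ) {x : ℝ} (hx : 0 < x)
    (h : x ≤ 4 * (k * m * n / δ) ^ 2) : Real.log x ≤ 2 * logFactor m k n δ := by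
  have h0 := hadm.one_le_div
  have h4 : Real.log 4 ≤ 2 := by
    have : Real.log 4 = 2 * Real.log 2 := by
      rw [show (4 : ℝ) = 2 ^ 2 by norm_num, Real.log_pow]
      norm_num
    linarith [Real.log_two_lt_d9]
  calc Real.log x ≤ Real.log (4 * (k * m * n / δ) ^ 2) := Real.log_le_log hx h
    _ = Real.log 4 + 2 * Real.log (k * m * n / δ) := by
        rw [Real.log_mul (by norm_num) (by positivity), Real.log_pow]
        norm_num
    _ ≤ 2 * logFactor m k n δ := by unfold logFactor; linarith

theorem Admissible.log_user_le (hadm : Admissible d m k n σ δ) :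
    Real.log (4 * k * m / δ) ≤ 2 * logFactor m k n δ := by
  have h0 := hadm.one_le_div
  have h1 : (1 : ℝ) ≤ n := by exact_mod_cast hadm.one_le_n
  have h2 : (0 : ℝ) < k := by exact_mod_cast hadm.k_pos
  have h3 : (0 : ℝ) < m := by exact_mod_cast hadm.m_pos
  have hδ := hadm.delta_pos
  refine hadm.log_le_two_mul_logFactor (by positivity) ?_
  calc (4 * k * m / δ : ℝ) ≤ 4 * k * m / δ * n := le_mul_of_one_le_right (by positivity) h1
    _ = 4 * (k * m * n / δ) := by ring
    _ ≤ 4 * (k * m * n / δ) ^ 2 := by gcongr; exact le_self_pow₀ h0 two_ne_zero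

theorem Admissible.log_phase_le (hadm : Admissible d m k n σ δ) {l : ℕ} (hl : 1 ≤ l)
    (hln : l ≤ n) : Real.log (2 * k * m * l * (l + 1) / δ) ≤ 2 * logFactor m k n δ := by
  have h1 : (1 : ℝ) ≤ n := by exact_mod_cast hadm.one_le_n
  have h2 : (1 : ℝ) ≤ k := by exact_mod_cast hadm.k_pos
  have h3 : (1 : ℝ) ≤ m := by exact_mod_cast hadm.m_pos
  have h4 : (1 : ℝ) ≤ l := by exact_mod_cast hl
  have h5 : (l : ℝ) ≤ n := by exact_mod_cast hln
  have hδ := hadm.delta_pos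
  refine hadm.log_le_two_mul_logFactor (by positivity) ?_
  have h6 : 1 ≤ (k * m / δ : ℝ) :=
    one_le_div_of_delta (one_le_mul_of_one_le_of_one_le h2 h3) hδ hadm.delta_lt
  calc (2 * k * m * l * (l + 1) / δ : ℝ) ≤ 2 * k * m * n * (n + n) / δ := by gcongr
    _ = 4 * (k * m / δ * n ^ 2) := by ring
    _ ≤ 4 * (k * m / δ * n ^ 2) * (k * m / δ) := le_mul_of_one_le_right (by positivity) h6
    _ = 4 * (k * m * n / δ) ^ 2 := by ring

theorem Admissible.log_collab_le (hadm : Admissible d m k n σ δ) {l : ℕ} (hl : 1 ≤ l)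
    (hln : l ≤ n) : Real.log (2 * k * l * (l + 1) / δ) ≤ 2 * logFactor m k n δ := by
  have h2 : (1 : ℝ) ≤ k := by exact_mod_cast hadm.k_pos
  have h3 : (1 : ℝ) ≤ m := by exact_mod_cast hadm.m_pos
  have h4 : (1 : ℝ) ≤ l := by exact_mod_cast hl
  have hδ := hadm.delta_pos
  refine le_trans (Real.log_le_log (by positivity) ?_) (hadm.log_phase_le hl hln)
  refine div_le_div_of_nonneg_right ?_ hδ.le
  have h5 : (2 * k : ℝ) ≤ 2 * k * m := le_mul_of_one_le_right (by positivity) h3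
  gcongr

theorem Admissible.sqrt_log_le (hadm : Admissible d m k n σ δ)
    {a : Fin k → EuclideanSpace ℝ (Fin d)} (ha : ∀ x, ‖a x‖ ≤ 1) {c L : ℝ} (hc0 : 0 ≤ c)
    (hc : c ≤ 2) (hL : L ≤ 2 * logFactor m k n δ) :
    √(c * (⨆ x, quad (σ ^ 2 • (1 : Matrix (Fin d) (Fin d) ℝ)) (a x)) * L)
      ≤ 2 * σ * logFactor m k n δ := by
  have hLF := hadm.one_le_logFactor
  have hσ := hadm.sigma_nonneg
  have hM := iSup_quad_smul_one_le (σ := σ) ha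
  have hM0 := iSup_quad_smul_one_nonneg (σ := σ) a
  refine Real.sqrt_le_iff.2 ⟨by positivity, ?_⟩
  calc c * (⨆ x, quad (σ ^ 2 • (1 : Matrix (Fin d) (Fin d) ℝ)) (a x)) * L
      ≤ c * (⨆ x, quad (σ ^ 2 • (1 : Matrix (Fin d) (Fin d) ℝ)) (a x))
          * (2 * logFactor m k n δ) := by gcongr
    _ ≤ 2 * σ ^ 2 * (2 * logFactor m k n δ) := by gcongr
    _ ≤ 2 * σ ^ 2 * (2 * logFactor m k n δ) * logFactor m k n δ :=
        le_mul_of_one_le_right (by positivity) hLF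
    _ = (2 * σ * logFactor m k n δ) ^ 2 := by ring

theorem Admissible.userDev_le (hadm : Admissible d m k n σ δ)
    {a : Fin k → EuclideanSpace ℝ (Fin d)} (ha : ∀ x, ‖a x‖ ≤ 1) :
    userDev m a (σ ^ 2 • (1 : Matrix (Fin d) (Fin d) ℝ)) δ ≤ 2 * σ * logFactor m k n δ :=
  hadm.sqrt_log_le ha zero_le_two le_rfl hadm.log_user_le

theorem Admissible.threshold_le (hadm : Admissible d m k n σ δ)
    {a : Fin k → EuclideanSpace ℝ (Fin d)} (ha : ∀ x, ‖a x‖ ≤ 1) :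
    threshold m a (σ ^ 2 • (1 : Matrix (Fin d) (Fin d) ℝ)) δ ≤ 4 * σ * logFactor m k n δ := by
  have hm : (1 : ℝ) ≤ m := by exact_mod_cast hadm.m_pos
  have hk : (1 : ℝ) ≤ k := by exact_mod_cast hadm.k_pos
  have hδ := hadm.delta_pos
  have h1 := hadm.userDev_le ha
  have h2 : Real.log (4 * k / δ) ≤ 2 * logFactor m k n δ := by
    refine le_trans (Real.log_le_log (by positivity) ?_) hadm.log_user_le
    exact div_le_div_of_nonneg_right (le_mul_of_one_le_right (by positivity) hm) hδ.le
  have h3 := hadm.sqrt_log_le ha (c := 2 / m) (by positivity)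
    (div_le_self zero_le_two hm) h2
  have h4 : threshold m a (σ ^ 2 • (1 : Matrix (Fin d) (Fin d) ℝ)) δ
      ≤ 2 * σ * logFactor m k n δ + 2 * σ * logFactor m k n δ := add_le_add h1 h3
  linarith

/-- A form of `CPPE.regretAtMost_of_rate_le` in which the gaps of the first phase, which enter
through `userDev`, are absorbed by a logarithmic factor. -/
theorem Admissible.regretAtMost_of_rate_le (hadm : Admissible d m k n σ δ) {η ρ B : ℝ}
    (hη : 0 < η) (hρ : 0 ≤ ρ)
    (hrate : ∀ a : Fin k → EuclideanSpace ℝ (Fin d), (∀ x, ‖a x‖ ≤ 1) → ∀ j < n,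
      η < eps (j + 1) →
        rate m a (σ ^ 2 • (1 : Matrix (Fin d) (Fin d) ℝ)) δ (j + 1) ≤ ρ / eps (j + 1) ^ 2)
    (hB : 16 * logFactor m k n δ * (m * (η * n + d ^ 2 + 2 * ρ * d / η)) ≤ B) :
    RegretAtMost.{u} d m k n σ δ B := by
  refine CPPE.regretAtMost_of_rate_le hadm hη hρ hrate fun a ha => le_trans ?_ hB
  have hLF := hadm.one_le_logFactor
  have h1 : 8 + 4 * userDev m a (σ ^ 2 • (1 : Matrix (Fin d) (Fin d) ℝ)) δ
      ≤ 16 * logFactor m k n δ := by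
    have h2 := hadm.userDev_le ha
    have h3 : σ * logFactor m k n δ ≤ logFactor m k n δ :=
      mul_le_of_le_one_left (by linarith) hadm.sigma_le
    linarith
  rw [mul_left_comm (16 * logFactor m k n δ)]
  gcongr

/-- The bound `m √(dn)`, which needs no collaboration. -/
theorem Admissible.regretAtMost_personal (hadm : Admissible d m k n σ δ) :
    RegretAtMost.{u} d m k n σ δ
      (528 * logFactor m k n δ ^ 2 * (m * √((d : ℝ) * n) + m * (d : ℝ) ^ 2)) := by
  have hd : (0 : ℝ) < d := by exact_mod_cast hadm.d_pos
  have hn : (0 : ℝ) < n := by exact_mod_cast hadm.one_le_n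
  have hm : (1 : ℝ) ≤ m := by exact_mod_cast hadm.m_pos
  have hLF := hadm.one_le_logFactor
  have hdn : 0 < √((d : ℝ) * n) := by positivity
  have hdn2 : √((d : ℝ) * n) ^ 2 = d * n := Real.sq_sqrt (by positivity)
  refine hadm.regretAtMost_of_rate_le (η := √((d : ℝ) * n) / n) (ρ := 16 * logFactor m k n δ)
    (by positivity) (by positivity) (fun a ha j hj _ => ?_) ?_
  · have hl1 : 1 ≤ j + 1 := Nat.succ_le_succ (Nat.zero_le j)
    have he := eps_pos (j + 1)
    unfold rate
    split_ifs
    · have h1 : (8 / (m * eps (j + 1) ^ 2) : ℝ) ≤ 8 / eps (j + 1) ^ 2 := by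
        gcongr
        exact le_mul_of_one_le_left (by positivity) hm
      calc _ ≤ 8 / eps (j + 1) ^ 2 * (2 * logFactor m k n δ) :=
            mul_le_mul h1 (hadm.log_collab_le hl1 hj)
              (log_collab_nonneg hadm.k_pos hl1 hadm.delta_pos hadm.delta_lt) (by positivity)
        _ = 16 * logFactor m k n δ / eps (j + 1) ^ 2 := by ring
    · calc _ ≤ 2 / eps (j + 1) ^ 2 * (2 * logFactor m k n δ) := by
            gcongr
            exact hadm.log_phase_le hl1 hj
        _ = 4 * logFactor m k n δ / eps (j + 1) ^ 2 := by ring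
        _ ≤ 16 * logFactor m k n δ / eps (j + 1) ^ 2 := by gcongr; norm_num
  · have h1 : √((d : ℝ) * n) / n * n = √((d : ℝ) * n) := by field_simp
    have h2 : 2 * (16 * logFactor m k n δ) * d / (√((d : ℝ) * n) / n)
        = 32 * logFactor m k n δ * √((d : ℝ) * n) := by
      field_simp
      rw [hdn2]
      ring
    rw [h1, h2]
    have h3 : √((d : ℝ) * n) + (d : ℝ) ^ 2 + 32 * logFactor m k n δ * √((d : ℝ) * n)
        ≤ 33 * logFactor m k n δ * (√((d : ℝ) * n) + (d : ℝ) ^ 2) := by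
      nlinarith [sq_nonneg (d : ℝ)]
    calc 16 * logFactor m k n δ * (m * (√((d : ℝ) * n) + (d : ℝ) ^ 2
          + 32 * logFactor m k n δ * √((d : ℝ) * n)))
        ≤ 16 * logFactor m k n δ * (m * (33 * logFactor m k n δ
          * (√((d : ℝ) * n) + (d : ℝ) ^ 2))) := by gcongr
      _ = 528 * logFactor m k n δ ^ 2 * (m * √((d : ℝ) * n) + m * (d : ℝ) ^ 2) := by ring

/-- The bound for populations of small diameter: `n s² σ² ≤ c d` with `1 ≤ s ≤ √m`. The phases
with `ε_l > η`, for `η` of order `√(d / n) / s`, are then all collaborative. -/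
theorem Admissible.regretAtMost_collab (hadm : Admissible d m k n σ δ) {c s : ℝ} (hc : 0 < c)
    (hs : 0 < s) (hsm : s ^ 2 ≤ m) (hσs : (n : ℝ) * (s ^ 2 * σ ^ 2) ≤ c * d) :
    RegretAtMost.{u} d m k n σ δ
      (16 * (33 + 8 * √c) * logFactor m k n δ ^ 2
        * (m / s * √((d : ℝ) * n) + m * (d : ℝ) ^ 2)) := by
  have hd : (0 : ℝ) < d := by exact_mod_cast hadm.d_pos
  have hn : (0 : ℝ) < n := by exact_mod_cast hadm.one_le_n
  have hm : (1 : ℝ) ≤ m := by exact_mod_cast hadm.m_pos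
  have hLF := hadm.one_le_logFactor
  have hσ := hadm.sigma_nonneg
  have hdn : 0 < √((d : ℝ) * n) := by positivity
  have hdn2 : √((d : ℝ) * n) ^ 2 = d * n := Real.sq_sqrt (by positivity)
  set r := √((d : ℝ) * n) / (n * s) with hr
  have hr0 : 0 < r := by positivity
  have hσr : σ ≤ √c * r := by
    rw [← pow_le_pow_iff_left₀ hσ (by positivity) two_ne_zero, mul_pow, Real.sq_sqrt hc.le, hr,
      div_pow, hdn2, ← mul_div_assoc, le_div_iff₀ (by positivity)]
    calc σ ^ 2 * (n * s) ^ 2 = n * (n * (s ^ 2 * σ ^ 2)) := by ring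
      _ ≤ n * (c * d) := by gcongr
      _ = c * (d * n) := by ring
  have h8 : 1 ≤ 1 + 8 * √c := by linarith [Real.sqrt_nonneg c]
  refine hadm.regretAtMost_of_rate_le (η := (1 + 8 * √c) * logFactor m k n δ * r)
    (ρ := 16 * logFactor m k n δ / m) (by positivity) (by positivity) (fun a ha j hj hjη => ?_) ?_
  · have hl1 : 1 ≤ j + 1 := Nat.succ_le_succ (Nat.zero_le j)
    have he := eps_pos (j + 1)
    have hcol : IsCollab m a (σ ^ 2 • (1 : Matrix (Fin d) (Fin d) ℝ)) δ (j + 1) := by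
      refine (hadm.threshold_le ha).trans ?_
      have h1 : σ * logFactor m k n δ ≤ √c * r * logFactor m k n δ := by gcongr
      have h2 : 0 < logFactor m k n δ * r := by positivity
      linarith
    rw [rate, if_pos hcol]
    calc _ ≤ 8 / (m * eps (j + 1) ^ 2) * (2 * logFactor m k n δ) := by
          gcongr
          exact hadm.log_collab_le hl1 hj
      _ = 16 * logFactor m k n δ / m / eps (j + 1) ^ 2 := by field_simp; norm_num
  · have h1 : (m : ℝ) * (r * n) = m / s * √((d : ℝ) * n) := by
      rw [hr]
      field_simp
    have h2 : (d : ℝ) / r ≤ m / s * √((d : ℝ) * n) := by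
      have h3 : (d : ℝ) / r = s * √((d : ℝ) * n) := by
        rw [hr]
        field_simp
        rw [hdn2]
      rw [h3]
      gcongr
      rw [le_div_iff₀ hs]
      linarith [sq s]
    have h3 : (m : ℝ) * (2 * (16 * logFactor m k n δ / m) * d
        / ((1 + 8 * √c) * logFactor m k n δ * r)) ≤ 32 * (m / s * √((d : ℝ) * n)) := by
      calc (m : ℝ) * (2 * (16 * logFactor m k n δ / m) * d
            / ((1 + 8 * √c) * logFactor m k n δ * r)) = 32 * (d / r) / (1 + 8 * √c) := by
            field_simp
            norm_num
        _ ≤ 32 * (d / r) := div_le_self (by positivity) h8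
        _ ≤ _ := by gcongr
    set W := (m : ℝ) / s * √((d : ℝ) * n) with hW
    have hW0 : 0 < W := by positivity
    have h4 : (m : ℝ) * ((1 + 8 * √c) * logFactor m k n δ * r * n + d ^ 2
        + 2 * (16 * logFactor m k n δ / m) * d / ((1 + 8 * √c) * logFactor m k n δ * r))
        ≤ (33 + 8 * √c) * logFactor m k n δ * (W + m * (d : ℝ) ^ 2) := by
      have h5 : (m : ℝ) * ((1 + 8 * √c) * logFactor m k n δ * r * n)
          = (1 + 8 * √c) * logFactor m k n δ * W := by rw [← h1]; ring
      have h6 : 32 * W ≤ 32 * (logFactor m k n δ * W) := by nlinarith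
      have h7 : (m : ℝ) * (d : ℝ) ^ 2
          ≤ (33 + 8 * √c) * logFactor m k n δ * (m * (d : ℝ) ^ 2) := by
        refine le_mul_of_one_le_left (by positivity) ?_
        exact one_le_mul_of_one_le_of_one_le (by linarith) hLF
      rw [mul_add, mul_add, h5]
      linarith
    calc _ ≤ 16 * logFactor m k n δ
          * ((33 + 8 * √c) * logFactor m k n δ * (W + m * (d : ℝ) ^ 2)) := by gcongr
      _ = _ := by ring

end RegretBounds

end CPPE

theorem theorem3 :
    ∃ p : ℕ,
      (∀ c : ℝ, 0 < c → ∃ K : ℝ, 0 < K ∧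
        ∀ (d m k n : ℕ) (σ δ : ℝ), CPPE.Admissible d m k n σ δ →
          (n : ℝ) * (m * σ ^ 2) ≤ c * d →
          CPPE.RegretAtMost.{u} d m k n σ δ
            (K * CPPE.logFactor m k n δ ^ p * (√((d : ℝ) * m * n) + m * (d : ℝ) ^ 2))) ∧
      (∀ c₁ c₂ : ℝ, 0 < c₁ → 0 < c₂ → ∃ K : ℝ, 0 < K ∧
        ∀ γ : ℝ, 0 ≤ γ → γ ≤ 1 / 2 →
        ∀ (d m k n : ℕ) (σ δ : ℝ), CPPE.Admissible d m k n σ δ →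
          c₁ * d ≤ (n : ℝ) * ((m : ℝ) ^ (2 * γ) * σ ^ 2) →
          (n : ℝ) * ((m : ℝ) ^ (2 * γ) * σ ^ 2) ≤ c₂ * d →
          CPPE.RegretAtMost.{u} d m k n σ δ
            (K * CPPE.logFactor m k n δ ^ p *
              ((m : ℝ) ^ (1 - γ) * √((d : ℝ) * n) + m * (d : ℝ) ^ 2))) ∧
      (∀ c : ℝ, 0 < c → ∃ K : ℝ, 0 < K ∧
        ∀ (d m k n : ℕ) (σ δ : ℝ), CPPE.Admissible d m k n σ δ →
          c * d ≤ (n : ℝ) * σ ^ 2 →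
          CPPE.RegretAtMost.{u} d m k n σ δ
            (K * CPPE.logFactor m k n δ ^ p * (m * √((d : ℝ) * n) + m * (d : ℝ) ^ 2))) := by
  refine ⟨2, fun c hc => ⟨16 * (33 + 8 * √c), by positivity, ?_⟩,
    fun _ c _ hc => ⟨16 * (33 + 8 * √c), by positivity, ?_⟩,
    fun _ _ => ⟨528, by norm_num, fun d m k n σ δ hadm _ => hadm.regretAtMost_personal⟩⟩
  · intro d m k n σ δ hadm h
    have hm : (0 : ℝ) < m := by exact_mod_cast hadm.m_pos
    have hsq : √(m : ℝ) ^ 2 = m := Real.sq_sqrt hm.le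
    have hmain := hadm.regretAtMost_collab (s := √(m : ℝ)) hc (by positivity) hsq.le
      (by rwa [hsq])
    rwa [Real.div_sqrt, ← Real.sqrt_mul hm.le, ← mul_assoc, mul_comm (m : ℝ) d] at hmain
  · intro γ _ hγ d m k n σ δ hadm _ h
    have hm : (1 : ℝ) ≤ m := by exact_mod_cast hadm.m_pos
    have hm0 : (0 : ℝ) < m := by linarith
    have hsq : ((m : ℝ) ^ γ) ^ 2 = (m : ℝ) ^ (2 * γ) := by
      rw [← Real.rpow_natCast, ← Real.rpow_mul hm0.le, mul_comm]
      norm_num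
    have hmain := hadm.regretAtMost_collab (s := (m : ℝ) ^ γ) hc (by positivity)
      (by
        rw [hsq]
        calc (m : ℝ) ^ (2 * γ) ≤ (m : ℝ) ^ (1 : ℝ) :=
              Real.rpow_le_rpow_of_exponent_le hm (by linarith)
          _ = m := Real.rpow_one _)
      (by rwa [hsq])
    rwa [← Real.rpow_one_sub' hm0.le (by linarith)] at hmain
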